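/- Let $K$ be a field of characteristic $0$. For $d\ge 0$ let $V_d$ be the $SL_2(K)$-module of binary forms of degree $d$, with coordinates $a_0,\dots,a_d$ given by writing a form as $\sum_{i}\binom{d}{i}a_iX^{d-i}Y^i$. Let $x_0,x_1$; $y_0,y_1$; $u_0,u_1$ be these coordinates on the three copies of $V_1$, and $v_0,v_1,v_2$ those on $V_2$, and let $\mathcal I=K[3V_1\oplus V_2]^{SL_2}$ be the algebra of polynomial $SL_2(K)$-invariant functions on $3V_1\oplus V_2$, graded by degree. Put $$\begin{aligned} L_1&=-x_0u_1v_1+x_0u_0v_2-x_1u_0v_1+x_1u_1v_0, & L_2&=-2u_0u_1v_1+u_0^2v_2+u_1^2v_0,\\ L_3&=-2v_1^2+2v_0v_2, & L_4&=-x_1^2v_0-x_0^2v_2+2x_0x_1v_1,\\ L_5&=-x_0u_1+x_1u_0, & L_6&=y_1u_1v_0-y_1u_0v_1-y_0u_1v_1+y_0u_0v_2,\\ L_7&=y_1^2v_0-2y_0y_1v_1+y_0^2v_2, & L_8&=-x_0y_1+x_1y_0,\\ L_9&=-y_0u_1+y_1u_0, & L_{10}&=x_0y_0v_2-x_0y_1v_1-x_1y_0v_1+x_1y_1v_0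 . \end{aligned}$$ (1) $L_1,\dots,L_{10}$ are homogeneous elements of $\mathcal I$ of degrees $3,3,2,3,2,3,3,2,2,3$ respectively, they generate the $K$-algebra $\mathcal I$, and no nine of them generate it. (2) Let $R=K[x_1,\dots,x_{10}]$, graded by $\deg x_i=\deg L_i$, and let $\varphi:R\to\mathcal I$ be the $K$-algebra homomorphism with $\varphi(x_i)=L_i$. The ideal $J=\ker\varphi$ is generated by the ten elements $$\begin{gathered} -x_5x_7+x_6x_8+x_9x_{10},\quad x_5x_6-x_2x_8-x_1x_9,\quad -x_1x_8+x_4x_9+x_5x_{10},\\ -x_6^2+x_2x_7-\tfrac12x_3x_9^2,\quad -x_4x_6-\tfrac12x_3x_5x_8-x_1x_{10},\quad -x_1x_6-\tfrac12x_3x_5x_9+x_2x_{10},\\ -x_1x_7-\tfrac12x_3x_8x_9+x_6x_{10},\quad -x_1^2-x_2x_4-\tfrac12x_3x_5^2,\quad -x_4x_7-\tfrac12x_3x_8^2-x_{10}^2,\\ x_2x_4x_8+\tfrac12x_3x_5^2x_8+x_1x_4x_9+x_1x_5x_{10}. \end{gathered}$$ (3) The graded $R$-module $\mathcal I$ (via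 $\varphi$) has a minimal graded free resolution of the form $$0\to R(-17)\to R(-11)^6\oplus R(-12)^3\to R(-8)^8\oplus R(-9)^8\to R(-5)^3\oplus R(-6)^6\to R\xrightarrow{\ \varphi\ }\mathcal I\to 0 ,$$ that is, the sequence is exact, its maps are homogeneous of degree $0$, and each map between free modules has image in $(x_1,\dots,x_{10})$ times its target. The projective (homological) dimension of the $R$-module $\mathcal I$ is $4$. -/

import Mathlib

open MvPolynomial
open scoped MatrixGroups

noncomputable section

namespace SL2Inv

universe u

/-! ### Binary forms and polynomial `SL₂`-invariants -/

/-- `V_d`: binary forms of degree `d`, i.e. homogeneous polynomials of degree `d` in two variables. -/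
abbrev BinaryForm (K : Type u) [Field K] (d : ℕ) : Submodule K (MvPolynomial (Fin 2) K) :=
  homogeneousSubmodule (Fin 2) K d

/-- Linear substitution of variables by `g`: `F(X, Y) ↦ F((X, Y) g)`. -/
def substitute {K : Type u} [Field K] (g : SL(2, K)) :
    MvPolynomial (Fin 2) K →ₐ[K] MvPolynomial (Fin 2) K :=
  aeval fun j => ∑ i, C (g.1 i j) * X i

lemma substitute_mem {K : Type u} [Field K] (g : SL(2, K)) {d : ℕ} {F : MvPolynomial (Fin 2) K}
    (hF : F ∈ BinaryForm K d) : substitute g F ∈ BinaryForm K d := by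
  rw [mem_homogeneousSubmodule] at hF ⊢
  have h := hF.aeval (fun j => ∑ i, C (g.1 i j) * X i : Fin 2 → MvPolynomial (Fin 2) K) (n := 1)
    (fun j => IsHomogeneous.sum _ _ _ fun i _ => (isHomogeneous_X K i).C_mul _)
  simpa [substitute] using h

lemma substitute_one {K : Type u} [Field K] (F : MvPolynomial (Fin 2) K) :
    substitute (1 : SL(2, K)) F = F := by
  have : substitute (1 : SL(2, K)) = AlgHom.id K _ := by
    apply MvPolynomial.algHom_ext
    intro j
    fin_cases j <;> simp [substitute]
  simp [this]

lemma substitute_mul {K : Type u} [Field K] (g h : SL(2, K)) (F : MvPolynomial (Fin 2) K) :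
    substitute (g * h) F = substitute g (substitute h F) := by
  have : substitute (g * h) = (substitute g).comp (substitute h) := by
    apply MvPolynomial.algHom_ext
    intro j
    simp only [substitute, AlgHom.comp_apply, aeval_X, Fin.sum_univ_two, map_add, map_mul,
      algHom_C, algebraMap_eq, Matrix.SpecialLinearGroup.coe_mul, Matrix.mul_apply]
    ring
  simp [this]

/-- The representation of `SL₂(K)` on `V_d`. -/
def binaryFormRep (K : Type u) [Field K] (d : ℕ) : Representation K SL(2, K) (BinaryForm K d) where
  toFun g := (substitute g).toLinearMap.restrict fun _ hF => substitute_mem g hF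
  map_one' := by
    ext1 F
    exact Subtype.ext (substitute_one F.1)
  map_mul' g h := by
    ext1 F
    exact Subtype.ext (substitute_mul g h F.1)

/-- The coordinates `a₀, …, a_d` on `V_d`, where a form is written as
`∑ i, (d choose i) * a_i * X ^ (d - i) * Y ^ i`. -/
def coordinate {K : Type u} [Field K] {d : ℕ} (F : BinaryForm K d) (i : Fin (d + 1)) : K :=
  ((d.choose i : ℕ) : K)⁻¹ * coeff (Finsupp.single 0 (d - i) + Finsupp.single 1 (i : ℕ)) F.1

/-- The coordinates on `V_{d₁} ⊕ ⋯ ⊕ V_{dₙ}`. -/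
def coordinates {K : Type u} [Field K] {n : ℕ} {d : Fin n → ℕ} (F : ∀ j, BinaryForm K (d j)) :
    (Σ j : Fin n, Fin (d j + 1)) → K :=
  fun c => coordinate (F c.1) c.2

/-- `K[V_{d₁} ⊕ ⋯ ⊕ V_{dₙ}]^{SL₂}`: the polynomials in the coordinates whose value at every point
of the representation is unchanged by the action of `SL₂(K)`. -/
def invariants (K : Type u) [Field K] {n : ℕ} (d : Fin n → ℕ) :
    Subalgebra K (MvPolynomial (Σ j : Fin n, Fin (d j + 1)) K) where
  carrier := {f | ∀ (g : SL(2, K)) (F : ∀ j, BinaryForm K (d j)),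
    eval (coordinates fun j => binaryFormRep K (d j) g (F j)) f = eval (coordinates F) f}
  mul_mem' ha hb g F := by simp [ha g F, hb g F]
  add_mem' ha hb g F := by simp [ha g F, hb g F]
  algebraMap_mem' r g F := by simp

/-! ### Graded free modules and minimal graded free resolutions -/

section Resolution

variable {K : Type u} [Field K] {σ : Type} (w : σ → ℕ)

/-- The degree `n` part of `R(-j)`, that is `R_{n - j}`, where `R = K[σ]` is graded by the
weights `w` of the variables. -/
def twistPiece (j n : ℕ) : Submodule K (MvPolynomial σ K) :=
  if j ≤ n then weightedHomogeneousSubmodule K w (n - j) else ⊥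

/-- The free `R`-module `R(-j₁) ⊕ ⋯ ⊕ R(-jᵣ)` for a list `s = [j₁, …, jᵣ]`. -/
abbrev FreeModule (K : Type u) [Field K] (σ : Type) (s : List ℕ) : Type u :=
  Fin s.length → MvPolynomial σ K

/-- The degree `n` part of `R(-j₁) ⊕ ⋯ ⊕ R(-jᵣ)`. -/
def freePiece (s : List ℕ) (n : ℕ) : Submodule K (FreeModule K σ s) :=
  Submodule.pi Set.univ fun a => twistPiece w (s.get a) n

/-- The ideal of `K[σ]` generated by the variables. -/
def irrelevantIdeal (K : Type u) [Field K] (σ : Type) : Ideal (MvPolynomial σ K) :=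
  Ideal.span (Set.range X)

/-- `⋯ → F₂ → F₁ → F₀ → M → 0` is a minimal graded free resolution of the graded `R`-module `M`
(with homogeneous parts `ℳ n`), where `F_i` is the graded free module with twists `s i`: the
sequence is exact, all maps are homogeneous of degree zero, and `F_{i+1}` maps into `𝔪 F_i`. -/
structure IsMinimalGradedFreeResolution {M : Type u} [AddCommGroup M]
    [Module (MvPolynomial σ K) M] (ℳ : ℕ → AddSubgroup M) (s : ℕ → List ℕ)
    (δ : ∀ i, FreeModule K σ (s (i + 1)) →ₗ[MvPolynomial σ K] FreeModule K σ (s i))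
    (ε : FreeModule K σ (s 0) →ₗ[MvPolynomial σ K] M) : Prop where
  surjective : Function.Surjective ε
  exact_zero : Function.Exact (δ 0) ε
  exact_succ : ∀ i, Function.Exact (δ (i + 1)) (δ i)
  graded_augmentation : ∀ n, ∀ v ∈ freePiece w (s 0) n, ε v ∈ ℳ n
  graded : ∀ i n, ∀ v ∈ freePiece w (s (i + 1)) n, δ i v ∈ freePiece w (s i) n
  minimal : ∀ i, LinearMap.range (δ i) ≤
    irrelevantIdeal K σ • (⊤ : Submodule (MvPolynomial σ K) (FreeModule K σ (s i)))

end Resolution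

/-! ### The algebra `K[3V₁ ⊕ V₂]^{SL₂}` -/

/-- `3V₁ ⊕ V₂`. -/
abbrev degs : Fin 4 → ℕ := ![1, 1, 1, 2]

/-- The coordinates `x₀, x₁`, `y₀, y₁`, `u₀, u₁` on the copies of `V₁` and `v₀, v₁, v₂` on `V₂`. -/
abbrev Coord : Type := Σ j : Fin 4, Fin (degs j + 1)

/-- The algebra `𝓘 = K[3V₁ ⊕ V₂]^{SL₂}`. -/
def invariantAlgebra (K : Type u) [Field K] : Subalgebra K (MvPolynomial Coord K) :=
  invariants K degs

/-- The ten listed invariants. -/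
def generator (K : Type u) [Field K] : Fin 10 → MvPolynomial Coord K :=
  let x₀ := X ⟨0, 0⟩
  let x₁ := X ⟨0, 1⟩
  let y₀ := X ⟨1, 0⟩
  let y₁ := X ⟨1, 1⟩
  let u₀ := X ⟨2, 0⟩
  let u₁ := X ⟨2, 1⟩
  let v₀ := X ⟨3, 0⟩
  let v₁ := X ⟨3, 1⟩
  let v₂ := X ⟨3, 2⟩
  ![-x₀ * u₁ * v₁ + x₀ * u₀ * v₂ - x₁ * u₀ * v₁ + x₁ * u₁ * v₀,
    -2 * u₀ * u₁ * v₁ + u₀ ^ 2 * v₂ + u₁ ^ 2 * v₀,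
    -2 * v₁ ^ 2 + 2 * v₀ * v₂,
    -x₁ ^ 2 * v₀ - x₀ ^ 2 * v₂ + 2 * x₀ * x₁ * v₁,
    -x₀ * u₁ + x₁ * u₀,
    y₁ * u₁ * v₀ - y₁ * u₀ * v₁ - y₀ * u₁ * v₁ + y₀ * u₀ * v₂,
    y₁ ^ 2 * v₀ - 2 * y₀ * y₁ * v₁ + y₀ ^ 2 * v₂,
    -x₀ * y₁ + x₁ * y₀,
    -y₀ * u₁ + y₁ * u₀,
    x₀ * y₀ * v₂ - x₀ * y₁ * v₁ - x₁ * y₀ * v₁ + x₁ * y₁ * v₀]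

/-- The degrees of the ten listed invariants, used as weights of the variables of `R`. -/
def weight : Fin 10 → ℕ := ![3, 3, 2, 3, 2, 3, 3, 2, 2, 3]

lemma eq_sum_monomial {K : Type u} [Field K] {d : ℕ} (F : BinaryForm K d) :
    F.1 = ∑ i : Fin (d + 1),
      monomial (Finsupp.single 0 (d - i) + Finsupp.single 1 (i : ℕ))
        (coeff (Finsupp.single 0 (d - i) + Finsupp.single 1 (i : ℕ)) F.1) := by
  classical
  have hF : F.1.IsHomogeneous d := (mem_homogeneousSubmodule d F.1).1 F.2
  ext m
  have hm : m = Finsupp.single 0 (m 0) + Finsupp.single 1 (m 1) := by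
    ext j; fin_cases j <;> simp
  rw [coeff_sum]
  simp only [coeff_monomial]
  by_cases h : m 0 + m 1 = d
  · rw [Finset.sum_eq_single (⟨m 1, by omega⟩ : Fin (d + 1))]
    · have h0 : d - m 1 = m 0 := by omega
      simp only [h0, ← hm, if_true]
    · intro b _ hb
      rw [if_neg]
      intro e
      apply hb
      ext
      have := DFunLike.congr_fun e 1
      simpa using this
    · simp
  · rw [Finset.sum_eq_zero, hF.coeff_eq_zero]
    · rw [hm]; simpa [Finsupp.degree_eq_sum] using h
    · intro b _
      rw [if_neg]
      intro e
      apply h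
      rw [← e]
      simp
      omega

lemma eq_linear {K : Type u} [Field K] (F : BinaryForm K 1) :
    F.1 = C (coordinate F 0) * X 0 + C (coordinate F 1) * X 1 := by
  conv_lhs => rw [eq_sum_monomial F]
  simp [Fin.sum_univ_two, coordinate, monomial_eq]

lemma eq_quadratic {K : Type u} [Field K] [CharZero K] (F : BinaryForm K 2) :
    F.1 = C (coordinate F 0) * X 0 ^ 2 + C (2 * coordinate F 1) * (X 0 * X 1)
      + C (coordinate F 2) * X 1 ^ 2 := by
  conv_lhs => rw [eq_sum_monomial F]
  simp [Fin.sum_univ_three, coordinate, monomial_eq, Finsupp.prod_add_index', pow_add]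
  rw [← Finsupp.single_tsub]

lemma coordinate_linear {K : Type u} [Field K] (F : BinaryForm K 1) (g : SL(2, K)) :
    coordinate (binaryFormRep K 1 g F) 0
        = g.1 0 0 * coordinate F 0 + g.1 0 1 * coordinate F 1 ∧
      coordinate (binaryFormRep K 1 g F) 1
        = g.1 1 0 * coordinate F 0 + g.1 1 1 * coordinate F 1 := by
  have h := eq_linear (binaryFormRep K 1 g F)
  have h2 : (binaryFormRep K 1 g F).1 = substitute g F.1 := rfl
  rw [h2, eq_linear F] at h
  have e0 := congrArg (eval ![1, 0]) h
  have e1 := congrArg (eval ![0, 1]) h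
  simp [substitute] at e0 e1
  constructor
  · rw [← e0]; ring
  · rw [← e1]; ring

lemma coordinate_quadratic {K : Type u} [Field K] [CharZero K] (F : BinaryForm K 2)
    (g : SL(2, K)) :
    coordinate (binaryFormRep K 2 g F) 0
        = g.1 0 0 ^ 2 * coordinate F 0 + 2 * g.1 0 0 * g.1 0 1 * coordinate F 1
          + g.1 0 1 ^ 2 * coordinate F 2 ∧
      coordinate (binaryFormRep K 2 g F) 1
        = g.1 0 0 * g.1 1 0 * coordinate F 0
          + (g.1 0 0 * g.1 1 1 + g.1 0 1 * g.1 1 0) * coordinate F 1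
          + g.1 0 1 * g.1 1 1 * coordinate F 2 ∧
      coordinate (binaryFormRep K 2 g F) 2
        = g.1 1 0 ^ 2 * coordinate F 0 + 2 * g.1 1 0 * g.1 1 1 * coordinate F 1
          + g.1 1 1 ^ 2 * coordinate F 2 := by
  have h := eq_quadratic (binaryFormRep K 2 g F)
  have h2 : (binaryFormRep K 2 g F).1 = substitute g F.1 := rfl
  rw [h2, eq_quadratic F] at h
  have e0 := congrArg (eval ![1, 0]) h
  have e1 := congrArg (eval ![0, 1]) h
  have e2 := congrArg (eval ![1, 1]) h
  simp [substitute] at e0 e1 e2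
  have two : (2 : K) ≠ 0 := two_ne_zero
  refine ⟨by linear_combination -e0, ?_, by linear_combination -e1⟩
  apply mul_left_cancel₀ two
  linear_combination e0 + e1 - e2

lemma generator_mem (K : Type u) [Field K] [CharZero K] (i : Fin 10) :
    generator K i ∈ invariantAlgebra K := by
  intro g F
  obtain ⟨hx0, hx1⟩ := coordinate_linear (F 0) g
  obtain ⟨hy0, hy1⟩ := coordinate_linear (F 1) g
  obtain ⟨hu0, hu1⟩ := coordinate_linear (F 2) g
  obtain ⟨hv0, hv1, hv2⟩ := coordinate_quadratic (F 3) g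
  have hdet : g.1 0 0 * g.1 1 1 - g.1 0 1 * g.1 1 0 = 1 := by
    rw [← Matrix.det_fin_two]; exact g.2
  have key : ∀ (G : ∀ j, BinaryForm K (degs j)) (x0 x1 y0 y1 u0 u1 v0 v1 v2 : K),
      coordinate (d := 1) (G 0) 0 = x0 → coordinate (d := 1) (G 0) 1 = x1 →
      coordinate (d := 1) (G 1) 0 = y0 → coordinate (d := 1) (G 1) 1 = y1 →
      coordinate (d := 1) (G 2) 0 = u0 → coordinate (d := 1) (G 2) 1 = u1 →
      coordinate (d := 2) (G 3) 0 = v0 → coordinate (d := 2) (G 3) 1 = v1 →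
      coordinate (d := 2) (G 3) 2 = v2 →
      eval (coordinates G) (generator K i) =
      ![-x0 * u1 * v1 + x0 * u0 * v2 - x1 * u0 * v1 + x1 * u1 * v0,
        -2 * u0 * u1 * v1 + u0 ^ 2 * v2 + u1 ^ 2 * v0,
        -2 * v1 ^ 2 + 2 * v0 * v2,
        -x1 ^ 2 * v0 - x0 ^ 2 * v2 + 2 * x0 * x1 * v1,
        -x0 * u1 + x1 * u0,
        y1 * u1 * v0 - y1 * u0 * v1 - y0 * u1 * v1 + y0 * u0 * v2,
        y1 ^ 2 * v0 - 2 * y0 * y1 * v1 + y0 ^ 2 * v2,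
        -x0 * y1 + x1 * y0,
        -y0 * u1 + y1 * u0,
        x0 * y0 * v2 - x0 * y1 * v1 - x1 * y0 * v1 + x1 * y1 * v0] i := by
    rintro G _ _ _ _ _ _ _ _ _ rfl rfl rfl rfl rfl rfl rfl rfl rfl
    fin_cases i <;> simp [generator] <;> rfl
  rw [key _ _ _ _ _ _ _ _ _ _ hx0 hx1 hy0 hy1 hu0 hu1 hv0 hv1 hv2,
    key F _ _ _ _ _ _ _ _ _ rfl rfl rfl rfl rfl rfl rfl rfl rfl]
  generalize g.1 0 0 = a at *
  generalize g.1 0 1 = b at *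
  generalize g.1 1 0 = c at *
  generalize g.1 1 1 = e at *
  generalize coordinate (d := 1) (F 0) 0 = x0
  generalize coordinate (d := 1) (F 0) 1 = x1
  generalize coordinate (d := 1) (F 1) 0 = y0
  generalize coordinate (d := 1) (F 1) 1 = y1
  generalize coordinate (d := 1) (F 2) 0 = u0
  generalize coordinate (d := 1) (F 2) 1 = u1
  generalize coordinate (d := 2) (F 3) 0 = v0
  generalize coordinate (d := 2) (F 3) 1 = v1
  generalize coordinate (d := 2) (F 3) 2 = v2
  clear key hx0 hx1 hy0 hy1 hu0 hu1 hv0 hv1 hv2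
  have hdet2 : (a * e - b * c) ^ 2 = 1 := by rw [hdet]; ring
  fin_cases i <;> simp
  · linear_combination (-x0 * u1 * v1 + x0 * u0 * v2 - x1 * u0 * v1 + x1 * u1 * v0) * hdet2
  · linear_combination (-2 * u0 * u1 * v1 + u0 ^ 2 * v2 + u1 ^ 2 * v0) * hdet2
  · linear_combination (-2 * v1 ^ 2 + 2 * v0 * v2) * hdet2
  · linear_combination (-x1 ^ 2 * v0 - x0 ^ 2 * v2 + 2 * x0 * x1 * v1) * hdet2
  · linear_combination (-x0 * u1 + x1 * u0) * hdet
  · linear_combination (y1 * u1 * v0 - y1 * u0 * v1 - y0 * u1 * v1 + y0 * u0 * v2) * hdet2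
  · linear_combination (y1 ^ 2 * v0 - 2 * y0 * y1 * v1 + y0 ^ 2 * v2) * hdet2
  · linear_combination (-x0 * y1 + x1 * y0) * hdet
  · linear_combination (-y0 * u1 + y1 * u0) * hdet
  · linear_combination (x0 * y0 * v2 - x0 * y1 * v1 - x1 * y0 * v1 + x1 * y1 * v0) * hdet2

/-- The polynomial ring `R = K[x₁, …, x₁₀]`; the variable `x_i` is `X (i - 1)`. -/
abbrev PolyRing (K : Type u) [Field K] : Type u := MvPolynomial (Fin 10) K

/-- The homomorphism `φ : R → 𝓘` that sends each variable to the corresponding listed invariant. -/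
def presentation (K : Type u) [Field K] [CharZero K] : PolyRing K →ₐ[K] invariantAlgebra K :=
  aeval fun i => ⟨generator K i, generator_mem K i⟩

/-- `𝓘` as an `R`-module via `φ`. -/
instance invariantModule (K : Type u) [Field K] [CharZero K] :
    Module (PolyRing K) (invariantAlgebra K) :=
  Module.compHom _ (presentation K).toRingHom

/-- The grading of `𝓘` by the degree of polynomials. -/
def invariantPiece (K : Type u) [Field K] (n : ℕ) : AddSubgroup (invariantAlgebra K) :=
  (homogeneousSubmodule Coord K n).toAddSubgroup.comap
    (invariantAlgebra K).val.toRingHom.toAddMonoidHom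

/-- The ten displayed relations. -/
def relation (K : Type u) [Field K] : Fin 10 → PolyRing K :=
  let x₁ := X 0
  let x₂ := X 1
  let x₃ := X 2
  let x₄ := X 3
  let x₅ := X 4
  let x₆ := X 5
  let x₇ := X 6
  let x₈ := X 7
  let x₉ := X 8
  let x₁₀ := X 9
  let half := C (1 / 2)
  ![-x₅ * x₇ + x₆ * x₈ + x₉ * x₁₀,
    x₅ * x₆ - x₂ * x₈ - x₁ * x₉,
    -x₁ * x₈ + x₄ * x₉ + x₅ * x₁₀,
    -x₆ ^ 2 + x₂ * x₇ - half * x₃ * x₉ ^ 2,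
    -x₄ * x₆ - half * x₃ * x₅ * x₈ - x₁ * x₁₀,
    -x₁ * x₆ - half * x₃ * x₅ * x₉ + x₂ * x₁₀,
    -x₁ * x₇ - half * x₃ * x₈ * x₉ + x₆ * x₁₀,
    -x₁ ^ 2 - x₂ * x₄ - half * x₃ * x₅ ^ 2,
    -x₄ * x₇ - half * x₃ * x₈ ^ 2 - x₁₀ ^ 2,
    x₂ * x₄ * x₈ + half * x₃ * x₅ ^ 2 * x₈ + x₁ * x₄ * x₉ + x₁ * x₅ * x₁₀]

/-- The twists of the free modules in the resolution: `F₀ = R`, `F₁ = R(-5)³ ⊕ R(-6)⁶`,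
`F₂ = R(-8)⁸ ⊕ R(-9)⁸`, `F₃ = R(-11)⁶ ⊕ R(-12)³`, `F₄ = R(-17)`, and `F_i = 0` for `i ≥ 5`. -/
def twists : ℕ → List ℕ
  | 0 => [0]
  | 1 => List.replicate 3 5 ++ List.replicate 6 6
  | 2 => List.replicate 8 8 ++ List.replicate 8 9
  | 3 => List.replicate 6 11 ++ List.replicate 3 12
  | 4 => [17]
  | _ => []

/-- The augmentation `F₀ = R → 𝓘`, which is `φ`. -/
def augmentation (K : Type u) [Field K] [CharZero K] :
    FreeModule K (Fin 10) (twists 0) →ₗ[PolyRing K] invariantAlgebra K where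
  toFun v := presentation K (v (0 : Fin 1))
  map_add' _ _ := map_add (presentation K) _ _
  map_smul' _ _ := map_mul (presentation K) _ _

end SL2Inv

end

/-!
Let `I` be the ideal of the listed relations and `F` the complex of free modules that starts with
the nine minimal ones. A multiplication and a self-duality on `F` make every relation act on it by a
map that is homotopic to zero, so `I` annihilates the homology. Since `I` contains a regular
sequence of length four, the length of `F`, the complex is exact. The same argument modulo `x₈`, and
modulo `x₈` and `x₄`, shows that `x₈` is regular on `R / I` and `x₄` on `R / (I + (x₈))`.

Modulo `I`, a power of `x₈` expresses `x₁`, `x₂`, `x₃`, `x₆` through the other variables, which take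
arbitrary values on the points with `x = (0, 1)` and `y = (L₈, 0)`. A polynomial that vanishes on
these points therefore lies in `I` up to a power of `x₈`, hence in `I`; this gives `J = I`. In the
same way, with `x₄` in place of `x₈` and points where `L₈ = 0`, a polynomial whose value at the
`L_i` is divisible by `L₈` lies in `I + (x₈)`. Every point with `L₈ ≠ 0` is equivalent under `SL₂`
to one of the former points, so for an invariant `f` some `L₈ ^ N * f` is a polynomial in the `L_i`,
and the factors `L₈` cancel one at a time.

No relation has a linear term, so no generator is redundant. A resolution of length four that could
be shortened would have a split last map, which minimality excludes.
-/

open RingTheory.Sequence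
open Function (Exact)
open scoped Matrix

noncomputable section

namespace SL2Inv

universe u v

section Acyclicity

variable {R : Type u} [CommRing R]

lemma isWeaklyRegular_of_flat {rs : List R} (hrs : IsWeaklyRegular R rs) (N : Type v)
    [AddCommGroup N] [Module R N] [Module.Flat R N] : IsWeaklyRegular N rs :=
  ((TensorProduct.lid R N).isWeaklyRegular_congr rs).1
    (IsWeaklyRegular.isWeaklyRegular_rTensor (M₂ := N) hrs)

variable {M : ℕ → Type v} [∀ i, AddCommGroup (M i)] [∀ i, Module R (M i)]
  {d : ∀ i, M (i + 1) →ₗ[R] M i} {rs : List R} {a : R}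

lemma mem_range_of_forall_smul_mem_range (hd : ∀ i, Exact (d (i + 1)) (d i))
    (hrs : ∀ i, IsWeaklyRegular (M i) rs) (hM : ∀ i, rs.length ≤ i → Subsingleton (M i)) {z : M 0}
    (hz : ∀ a ∈ rs, a • z ∈ LinearMap.range (d 0)) : z ∈ LinearMap.range (d 0) := by
  induction rs generalizing M with
  | nil =>
    have := hM 0 le_rfl
    exact Subsingleton.elim 0 z ▸ zero_mem _
  | cons a rs ih =>
    obtain ⟨y, hy⟩ := hz a List.mem_cons_self
    have hreg i := (isWeaklyRegular_cons_iff (M i) a rs).1 (hrs i)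
    -- If `a • z = d y`, then `y` is a cycle modulo `a`, killed by `rs` in the homology modulo `a`.
    have hquot : (Submodule.Quotient.mk y : QuotSMulTop a (M 1)) ∈
        LinearMap.range (QuotSMulTop.map a (d 1)) := by
      refine ih (M := fun i => QuotSMulTop a (M (i + 1)))
        (d := fun i => QuotSMulTop.map a (d (i + 1)))
        (fun i => QuotSMulTop.map_first_exact_on_four_term_exact_of_isSMulRegular_last
          (hd (i + 1)) (hd i) (hreg i).1) (fun i => (hreg _).2)
        (fun i hi => ?_) fun b hb => ?_
      · have := hM (i + 1) (Nat.succ_le_succ hi)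
        infer_instance
      · obtain ⟨w, hw⟩ := hz b (List.mem_cons_of_mem a hb)
        obtain ⟨l, hl⟩ := (hd 0 (b • y - a • w)).1 (by simp [hy, hw, smul_comm a b])
        refine ⟨Submodule.Quotient.mk l, ?_⟩
        rw [QuotSMulTop.map_apply_mk, hl, ← Submodule.Quotient.mk_smul, Submodule.Quotient.eq,
          sub_sub_cancel_left, neg_mem_iff]
        exact Submodule.smul_mem_pointwise_smul _ _ _ trivial
    obtain ⟨l, hl⟩ := hquot
    obtain ⟨l, rfl⟩ := Submodule.Quotient.mk_surjective _ l
    rw [QuotSMulTop.map_apply_mk, Submodule.Quotient.eq] at hl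
    obtain ⟨w, -, hw⟩ := hl
    change a • w = d 1 l - y at hw
    refine ⟨-w, (hreg 0).1 ?_⟩
    have hdl : d 0 (d 1 l) = 0 := (hd 0).apply_apply_eq_zero l
    simp [← map_smul, hw, hdl, hy]

/-- A form of the acyclicity lemma of Peskine and Szpiro. -/
theorem exact_of_forall_smul_mem_range (hd : ∀ i z, d i (d (i + 1) z) = 0)
    (hrs : ∀ i, IsWeaklyRegular (M i) rs) (hM : ∀ i, rs.length < i → Subsingleton (M i))
    (hhom : ∀ a ∈ rs, ∀ i z, d i z = 0 → a • z ∈ LinearMap.range (d (i + 1))) (i : ℕ) :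
    Exact (d (i + 1)) (d i) := by
  obtain ⟨n, hn⟩ : ∃ n, rs.length ≤ i + n := ⟨rs.length, Nat.le_add_left _ _⟩
  induction n generalizing i with
  | zero =>
    have := hM (i + 1) (Nat.lt_succ_of_le hn)
    exact fun z => ⟨fun _ => Subsingleton.elim 0 z ▸ zero_mem (LinearMap.range (d (i + 1))),
      fun _ => Subsingleton.elim 0 z ▸ map_zero _⟩
  | succ n ih =>
    refine fun z => ⟨fun hz => ?_, ?_⟩
    · exact mem_range_of_forall_smul_mem_range (M := fun j => M (i + 1 + j))
        (d := fun j => d (i + 1 + j)) (fun j => ih (i + 1 + j) (by lia)) (fun j => hrs (i + 1 + j))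
        (fun j hj => hM (i + 1 + j) (by lia)) fun a ha => hhom a ha i z hz
    · rintro ⟨y, rfl⟩
      exact hd i y

lemma isSMulRegular_quotient_range (hd : ∀ i, Exact (d (i + 1)) (d i))
    (hrs : ∀ i, IsWeaklyRegular (M i) (a :: rs)) (hM : ∀ i, rs.length < i → Subsingleton (M i))
    (hann : ∀ b ∈ rs, ∀ z : M 0, b • z ∈ LinearMap.range (d 0)) :
    IsSMulRegular (M 0 ⧸ LinearMap.range (d 0)) a := by
  refine (isSMulRegular_quotient_iff_mem_of_smul_mem _ a).2 fun z hz =>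
    mem_range_of_forall_smul_mem_range hd hrs (fun i hi => hM i hi) fun b hb => ?_
  obtain rfl | hb := List.mem_cons.1 hb
  exacts [hz, hann b hb z]

lemma exact_quotSMulTop_map (hd : ∀ i, Exact (d (i + 1)) (d i))
    (ha : ∀ i, IsSMulRegular (M i) a) (ha₀ : IsSMulRegular (M 0 ⧸ LinearMap.range (d 0)) a) :
    ∀ i, Exact (QuotSMulTop.map a (d (i + 1))) (QuotSMulTop.map a (d i))
  | 0 => QuotSMulTop.map_first_exact_on_four_term_exact_of_isSMulRegular_last (hd 0)
      (LinearMap.exact_iff.2 (Submodule.ker_mkQ _)) ha₀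
  | i + 1 => QuotSMulTop.map_first_exact_on_four_term_exact_of_isSMulRegular_last (hd (i + 1))
      (hd i) (ha i)

end Acyclicity

section Isolate

variable {R : Type u} [CommRing R]

lemma mem_map_C_of_monic_mul_mem {I : Ideal R} {p f : Polynomial R} (hp : p.Monic)
    (h : p * f ∈ I.map Polynomial.C) : f ∈ I.map Polynomial.C := by
  have mem_iff (g : Polynomial R) :
      g ∈ I.map Polynomial.C ↔ g.map (Ideal.Quotient.mk I) = 0 := by
    simp [Ideal.mem_map_C_iff, Polynomial.ext_iff, Ideal.Quotient.eq_zero_iff_mem]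
  rw [mem_iff, Polynomial.map_mul] at h
  exact (mem_iff f).2 (((hp.map _).mul_right_eq_zero_iff).1 h)

lemma isWeaklyRegular_append_singleton_iff {rs : List R} {a : R} :
    IsWeaklyRegular R (rs ++ [a]) ↔ IsWeaklyRegular R rs ∧
      ∀ f, a * f ∈ Ideal.ofList rs → f ∈ Ideal.ofList rs := by
  rw [isWeaklyRegular_append_iff, isWeaklyRegular_singleton_iff,
    isSMulRegular_quotient_iff_mem_of_smul_mem]
  simp

variable {σ : Type*} [DecidableEq σ]

/-- A polynomial viewed as a polynomial in the single variable `X i`, with coefficients that do not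
involve `X i`. The coefficient ring is not shrunk, so that `f` does not involve `X i` if and only if
`isolate i f = Polynomial.C f`. -/
def isolate (i : σ) : MvPolynomial σ R →ₐ[R] Polynomial (MvPolynomial σ R) :=
  aeval fun j => if j = i then Polynomial.X else Polynomial.C (X j)

lemma isolate_X (i j : σ) : isolate i (X j : MvPolynomial σ R) =
    if j = i then Polynomial.X else Polynomial.C (X j) :=
  aeval_X _ _

lemma eval_isolate (i : σ) (f : MvPolynomial σ R) : (isolate i f).eval (X i) = f := by
  have h : ((Polynomial.aeval (X i : MvPolynomial σ R)).restrictScalars R).comp (isolate i) =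
      AlgHom.id R (MvPolynomial σ R) := by
    ext j
    simp only [AlgHom.comp_apply, isolate_X]
    split_ifs with hj <;> simp [hj]
  simpa [Polynomial.aeval_def] using congrArg (fun φ => φ f) h

lemma isolate_mem_map_C_iff {i : σ} {rs : List (MvPolynomial σ R)}
    (hrs : ∀ g ∈ rs, isolate i g = Polynomial.C g) {f : MvPolynomial σ R} :
    isolate i f ∈ (Ideal.ofList rs).map Polynomial.C ↔ f ∈ Ideal.ofList rs := by
  constructor <;> intro hf
  · have h := Ideal.mem_map_of_mem (Polynomial.evalRingHom (X i)) hf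
    rwa [Ideal.map_map, Polynomial.coe_evalRingHom, eval_isolate,
      show (Polynomial.evalRingHom (X i : MvPolynomial σ R)).comp Polynomial.C = RingHom.id _ by
        ext <;> simp, Ideal.map_id] at h
  · have h := Ideal.mem_map_of_mem (isolate (R := R) i).toRingHom hf
    rwa [Ideal.map_ofList,
      show rs.map (isolate (R := R) i).toRingHom = rs.map Polynomial.C from List.map_congr_left hrs,
      ← Ideal.map_ofList] at h

lemma isWeaklyRegular_append_sub_X_pow {i : σ} {rs : List (MvPolynomial σ R)}
    {c : MvPolynomial σ R} {n : ℕ} (hn : n ≠ 0)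
    (hfree : ∀ g ∈ c :: rs, isolate i g = Polynomial.C g)
    (hrs : IsWeaklyRegular (MvPolynomial σ R) rs) :
    IsWeaklyRegular (MvPolynomial σ R) (rs ++ [c - X i ^ n]) := by
  refine isWeaklyRegular_append_singleton_iff.2 ⟨hrs, fun f hf => ?_⟩
  have hfree' : ∀ g ∈ rs, isolate i g = Polynomial.C g :=
    fun g hg => hfree g (List.mem_cons_of_mem c hg)
  refine (isolate_mem_map_C_iff hfree').1 (mem_map_C_of_monic_mul_mem
    (Polynomial.monic_X_pow_sub_C c hn) ?_)
  have h := (isolate_mem_map_C_iff hfree').2 hf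
  rw [map_mul, map_sub, map_pow, isolate_X, if_pos rfl, hfree c List.mem_cons_self] at h
  rwa [← neg_sub, neg_mul, neg_mem_iff]

end Isolate

section Complex

variable {R : Type u} [CommRing R] (x : Fin 10 → R) (a : Fin 9 → R)

/-- The minimal generators of the ideal of relations: the first nine displayed relations, with `x 2`
standing for half of the third variable, so that no denominators occur. The resolution is self-dual
in their order; see `dualRelation`. -/
def minimalRelation : Fin 9 → R :=
  ![-x 4 * x 6 + x 5 * x 7 + x 8 * x 9, -x 0 * x 8 - x 1 * x 7 + x 4 * x 5,
    -x 0 * x 7 + x 3 * x 8 + x 4 * x 9, x 1 * x 6 - x 2 * x 8 ^ 2 - x 5 ^ 2,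
    -x 0 * x 9 - x 2 * x 4 * x 7 - x 3 * x 5, -x 0 * x 5 + x 1 * x 9 - x 2 * x 4 * x 8,
    -x 0 * x 6 - x 2 * x 7 * x 8 + x 5 * x 9, -x 0 ^ 2 - x 1 * x 3 - x 2 * x 4 ^ 2,
    -x 2 * x 7 ^ 2 - x 3 * x 6 - x 9 ^ 2]

/-- The first syzygies of the minimal relations. The columns are ordered so that the rows span an
isotropic subspace for the form `∑ k, z k * z (k + 8)`. -/
def syzygyMatrix : Matrix (Fin 9) (Fin 16) R :=
  !![-x 5, -x 1, 0, 0, -x 3, x 9, -x 0, 0, 0, 0, x 2 * x 8, x 2 * x 7, 0, 0, 0, -x 2 * x 4;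
     -x 6, -x 5, -x 3, x 0, 0, 0, -x 9, x 9, 0, 0, 0, 0, -x 2 * x 8, x 2 * x 4, x 2 * x 7,
     x 2 * x 7;
     0, 0, -x 0, -x 1, x 9, x 6, 0, -x 5, x 2 * x 4, -x 2 * x 7, 0, 0, 0, 0, -x 2 * x 8, 0;
     -x 7, -x 4, 0, 0, 0, 0, 0, 0, 0, 0, x 9, 0, x 0, 0, -x 3, 0;
     0, 0, -x 4, 0, -x 7, 0, 0, -x 8, -x 0, -x 9, 0, -x 6, 0, -x 1, x 5, 0;
     0, x 8, 0, x 4, 0, 0, -x 7, x 7, x 3, 0, -x 6, 0, -x 5, -x 0, -x 9, -x 9;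
     x 8, 0, 0, 0, 0, -x 7, x 4, 0, 0, -x 3, x 5, x 9, x 1, 0, 0, -x 0;
     0, 0, x 7, -x 8, 0, 0, 0, 0, x 9, 0, 0, 0, 0, x 5, 0, x 6;
     0, 0, 0, 0, x 4, x 8, 0, 0, 0, x 0, 0, x 5, 0, 0, -x 1, -x 1]

/-- The two by two minor of rows `i` and `j` of the matrix with columns `a` and `b`, as a linear map
in `b`. -/
def minor (i j : Fin 9) : (Fin 9 → R) →ₗ[R] R :=
  a i • LinearMap.proj j - a j • LinearMap.proj i

@[simp]
lemma minor_apply (i j : Fin 9) (b : Fin 9 → R) : minor a i j b = a i * b j - a j * b i :=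
  rfl

/-- The products `a * b` in a multiplicative structure on the complex with first two differentials
`minimalRelation` and `syzygyMatrix`; the Leibniz rule is `syzygyMatrix_mulVec_product`. Hence
multiplication by `a` is a homotopy from zero to multiplication by `minimalRelation x ⬝ᵥ a`. The
coefficients are those of a homogeneous solution of the Leibniz rule. -/
def product : (Fin 9 → R) →ₗ[R] (Fin 16 → R) :=
  let m := minor a
  LinearMap.pi ![
     x 4 • m 0 1 - x 5 • m 0 3 + x 9 • m 0 6 + x 1 • m 1 3 - x 0 • m 1 6 - (x 2 * x 8) • m 3 6
       - (x 2 * x 7) • m 3 8,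
     -x 7 • m 0 1 + x 6 • m 0 3 + x 9 • m 0 5 - x 5 • m 1 3 - x 0 • m 1 5 - x 9 • m 2 3
       - (x 2 * x 7) • m 3 4 - (x 2 * x 8) • m 3 5 - (x 2 * x 4) • m 3 7,
     x 8 • m 1 2 - x 5 • m 1 4 - x 1 • m 1 7 - x 6 • m 1 8 - x 9 • m 2 4 - x 0 • m 2 7
       - (x 2 * x 4) • m 4 7 + (x 2 * x 7) • m 7 8,
     -x 9 • m 0 7 + x 7 • m 1 2 + x 0 • m 1 7 + x 9 • m 2 5 - x 3 • m 2 7 + (x 2 * x 8) • m 3 7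
       + (x 2 * x 4) • m 5 7 + (x 2 * x 7) • m 6 7,
     x 8 • m 0 2 - x 5 • m 0 4 - x 1 • m 0 7 - x 6 • m 0 8 + x 9 • m 2 8 - (x 2 * x 7) • m 4 8
       - (x 2 * x 4) • m 7 8,
     -x 4 • m 0 2 + x 9 • m 0 8 - x 0 • m 1 8 - x 1 • m 2 3 + x 0 • m 2 6 + x 3 • m 2 8
       - (x 2 * x 8) • m 3 8 - (x 2 * x 4) • m 5 8 - (x 2 * x 7) • m 6 8,
     -x 8 • m 0 1 - x 7 • m 0 2 - x 9 • m 0 4 - x 5 • m 0 5 - x 6 • m 0 6 - x 0 • m 0 7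
       + x 1 • m 1 5 + x 5 • m 1 6 - x 9 • m 1 8 + x 9 • m 2 6 - (x 2 * x 7) • m 4 6
       - (x 2 * x 8) • m 5 6 - (x 2 * x 7) • m 5 8 + (x 2 * x 4) • m 6 7,
     -x 7 • m 0 2 - x 9 • m 0 4 - x 4 • m 1 2 + x 0 • m 1 4 - x 5 • m 2 3 - x 3 • m 2 4
       - x 0 • m 2 5 + x 9 • m 2 6 + (x 2 * x 8) • m 3 4 - (x 2 * x 4) • m 4 5
       - (x 2 * x 7) • m 4 6,
     x 7 • m 2 4 + x 8 • m 2 5 + x 4 • m 2 7 - x 5 • m 4 5 - x 0 • m 4 7 + x 1 • m 5 7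
       + x 6 • m 5 8 + x 9 • m 7 8,
     -x 8 • m 2 6 - x 7 • m 2 8 + x 5 • m 4 6 - x 9 • m 4 8 - x 1 • m 6 7 - x 6 • m 6 8
       - x 0 • m 7 8,
     x 8 • m 0 3 + x 4 • m 0 5 + x 7 • m 0 6 - x 1 • m 3 5 - x 5 • m 3 6 + x 9 • m 3 8
       - x 0 • m 5 6,
     x 4 • m 0 4 + x 7 • m 0 8 + x 4 • m 1 8 - x 1 • m 3 4 - x 5 • m 3 8 - x 0 • m 4 6
       - x 3 • m 4 8 - x 0 • m 5 8 + x 9 • m 6 8,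
     -x 8 • m 1 3 - x 4 • m 1 5 - x 7 • m 1 6 - x 7 • m 2 3 + x 9 • m 3 4 + x 5 • m 3 5
       + x 6 • m 3 6 + x 0 • m 3 7 + x 9 • m 5 6,
     x 7 • m 0 7 + x 7 • m 1 4 + x 4 • m 1 7 - x 5 • m 3 7 + x 9 • m 4 5 - x 3 • m 4 7
       - x 0 • m 5 7 + x 9 • m 6 7,
     -x 8 • m 2 3 - x 5 • m 3 4 - x 1 • m 3 7 - x 6 • m 3 8,
     -x 4 • m 0 7 + x 7 • m 1 8 + x 1 • m 3 7 - x 9 • m 5 8 - x 0 • m 6 7 + x 3 • m 7 8]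

set_option maxRecDepth 10000 in
set_option maxHeartbeats 4000000 in
-- `ring` has to expand identities in 28 variables.
lemma syzygyMatrix_mulVec_product (b : Fin 9 → R) :
    syzygyMatrix x *ᵥ product x a b =
      (minimalRelation x ⬝ᵥ a) • b - (minimalRelation x ⬝ᵥ b) • a := by
  ext i
  fin_cases i <;>
    simp [syzygyMatrix, dotProduct, Fin.sum_univ_ofNat, product, minimalRelation] <;> ring

/-- Interchanges the two halves of a vector: the isomorphism of `R ^ 16` with its dual given by the
polar form of `hyperbolicForm`. -/
def swap (z : Fin 16 → R) : Fin 16 → R :=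
  fun k => z (k + 8)

/-- The hyperbolic quadratic form on `R ^ 16`. -/
def hyperbolicForm (z : Fin 16 → R) : R :=
  ∑ k : Fin 8, z (k.castAdd 8) * z (k.natAdd 8)

set_option maxRecDepth 10000 in
set_option maxHeartbeats 4000000 in
-- `ring` has to expand an identity in 35 variables.
lemma swap_dotProduct_product_syzygyMatrix_mulVec (z : Fin 16 → R) :
    swap z ⬝ᵥ product x a (syzygyMatrix x *ᵥ z) =
      (minimalRelation x ⬝ᵥ a) * hyperbolicForm z := by
  simp [syzygyMatrix, dotProduct, Fin.sum_univ_ofNat, product, minimalRelation, swap,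
    hyperbolicForm]
  ring

lemma hyperbolicForm_add (z w : Fin 16 → R) :
    hyperbolicForm (z + w) = hyperbolicForm z + hyperbolicForm w + swap z ⬝ᵥ w := by
  simp [hyperbolicForm, swap, dotProduct, Fin.sum_univ_ofNat]
  ring

lemma minimalRelation_vecMul : minimalRelation x ᵥ* syzygyMatrix x = 0 := by
  ext k
  fin_cases k <;>
    simp [Matrix.vecMul, dotProduct, Fin.sum_univ_ofNat, minimalRelation, syzygyMatrix] <;> ring

set_option maxHeartbeats 1000000 in
-- `ring` has to expand an identity in 19 variables.
lemma hyperbolicForm_vecMul (b : Fin 9 → R) : hyperbolicForm (b ᵥ* syzygyMatrix x) = 0 := by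
  simp [hyperbolicForm, Matrix.vecMul, dotProduct, Fin.sum_univ_ofNat, syzygyMatrix]
  ring

variable {x a}

omit [CommRing R] in
lemma swap_swap (z : Fin 16 → R) : swap (swap z) = z := by
  ext k
  simp [swap, add_assoc, show (8 + 8 : Fin 16) = 0 from rfl]

lemma swap_dotProduct_product {z : Fin 16 → R} (hz : syzygyMatrix x *ᵥ z = 0) (w : Fin 16 → R) :
    swap z ⬝ᵥ product x a (syzygyMatrix x *ᵥ w) = (minimalRelation x ⬝ᵥ a) * (swap z ⬝ᵥ w) := by
  -- Polarise the previous identity.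
  have hadd := swap_dotProduct_product_syzygyMatrix_mulVec x a (z + w)
  have hz' := swap_dotProduct_product_syzygyMatrix_mulVec x a z
  have hw := swap_dotProduct_product_syzygyMatrix_mulVec x a w
  rw [show swap (z + w) = swap z + swap w from rfl, Matrix.mulVec_add, hz, zero_add,
    hyperbolicForm_add, add_dotProduct, hw] at hadd
  rw [hz, map_zero, dotProduct_zero] at hz'
  linear_combination hadd - hz'

lemma exists_vecMul_eq_smul_swap {z : Fin 16 → R} (hz : syzygyMatrix x *ᵥ z = 0) :
    ∃ y, y ᵥ* syzygyMatrix x = (minimalRelation x ⬝ᵥ a) • swap z := by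
  refine ⟨swap z ᵥ* (LinearMap.toMatrix' (product x a)), dotProduct_eq _ _ fun w => ?_⟩
  rw [← Matrix.dotProduct_mulVec, ← Matrix.dotProduct_mulVec, LinearMap.toMatrix'_mulVec,
    smul_dotProduct, smul_eq_mul]
  exact swap_dotProduct_product hz w

lemma smul_eq_of_vecMul_eq_zero {z : Fin 9 → R} (hz : z ᵥ* syzygyMatrix x = 0) :
    (minimalRelation x ⬝ᵥ a) • z = (z ⬝ᵥ a) • minimalRelation x := by
  refine dotProduct_eq _ _ fun w => ?_
  have h := congrArg (z ⬝ᵥ ·) (syzygyMatrix_mulVec_product x a w)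
  simp only [Matrix.dotProduct_mulVec, hz, zero_dotProduct, dotProduct_sub, dotProduct_smul,
    smul_eq_mul] at h
  simp only [smul_dotProduct, smul_eq_mul]
  linear_combination -h

lemma mulVec_swap_vecMul (b : Fin 9 → R) : syzygyMatrix x *ᵥ swap (b ᵥ* syzygyMatrix x) = 0 := by
  refine dotProduct_eq _ _ fun w => ?_
  have h := hyperbolicForm_vecMul x (b + w)
  rw [Matrix.add_vecMul, hyperbolicForm_add, hyperbolicForm_vecMul, hyperbolicForm_vecMul] at h
  rw [dotProduct_comm, Matrix.dotProduct_mulVec, zero_dotProduct, dotProduct_comm]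
  simpa using h

variable (x)

/-- The third differential: the transpose of `syzygyMatrix`, in the bases of `R ^ 16` and `R ^ 9`
that make the resolution self-dual. -/
def dualSyzygyMatrix : Matrix (Fin 16) (Fin 9) R :=
  (syzygyMatrix x)ᵀ.submatrix (· + 8) (· + 3)

/-- The last differential: the minimal relations in the dual order. -/
def dualRelation : Fin 9 → R := fun j => minimalRelation x (j + 3)

lemma dualSyzygyMatrix_mulVec (z : Fin 9 → R) :
    dualSyzygyMatrix x *ᵥ z = swap ((fun j => z (j - 3)) ᵥ* syzygyMatrix x) := by
  ext k
  rw [swap, Matrix.vecMul, dotProduct_comm]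
  change ∑ i, dualSyzygyMatrix x k i * z i = ∑ i, syzygyMatrix x i (k + 8) * z (i - 3)
  exact Fintype.sum_equiv (Equiv.addRight 3) _ _ fun j => by simp [dualSyzygyMatrix]

lemma syzygyMatrix_mulVec_dualSyzygyMatrix_mulVec (z : Fin 9 → R) :
    syzygyMatrix x *ᵥ (dualSyzygyMatrix x *ᵥ z) = 0 := by
  rw [dualSyzygyMatrix_mulVec, mulVec_swap_vecMul]

lemma dualSyzygyMatrix_mulVec_dualRelation : dualSyzygyMatrix x *ᵥ dualRelation x = 0 := by
  rw [dualSyzygyMatrix_mulVec]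
  simp only [dualRelation, sub_add_cancel, minimalRelation_vecMul]
  rfl

variable {x}

lemma exists_syzygyMatrix_mulVec_eq_smul {z : Fin 9 → R} (hz : minimalRelation x ⬝ᵥ z = 0) :
    ∃ y, syzygyMatrix x *ᵥ y = (minimalRelation x ⬝ᵥ a) • z :=
  ⟨product x a z, by rw [syzygyMatrix_mulVec_product, hz, zero_smul, sub_zero]⟩

lemma exists_dualSyzygyMatrix_mulVec_eq_smul {z : Fin 16 → R} (hz : syzygyMatrix x *ᵥ z = 0) :
    ∃ y, dualSyzygyMatrix x *ᵥ y = (minimalRelation x ⬝ᵥ a) • z := by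
  obtain ⟨y, hy⟩ := exists_vecMul_eq_smul_swap (a := a) hz
  refine ⟨fun j => y (j + 3), ?_⟩
  simp only [dualSyzygyMatrix_mulVec, sub_add_cancel, hy]
  exact congrArg ((minimalRelation x ⬝ᵥ a) • ·) (swap_swap z)

lemma exists_smul_dualRelation_eq_smul {z : Fin 9 → R} (hz : dualSyzygyMatrix x *ᵥ z = 0) :
    ∃ y : R, y • dualRelation x = (minimalRelation x ⬝ᵥ a) • z := by
  rw [dualSyzygyMatrix_mulVec] at hz
  have hz' : (fun j => z (j - 3)) ᵥ* syzygyMatrix x = 0 := by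
    rw [← swap_swap (_ ᵥ* _), hz]
    rfl
  refine ⟨(fun j => z (j - 3)) ⬝ᵥ a, funext fun j => ?_⟩
  simpa [dualRelation] using (congrFun (smul_eq_of_vecMul_eq_zero (a := a) hz') (j + 3)).symm

lemma mul_eq_zero_of_smul_dualRelation_eq_zero {c : R} (hc : c • dualRelation x = 0) :
    (minimalRelation x ⬝ᵥ a) * c = 0 := by
  have h : c • minimalRelation x = 0 := funext fun j => by
    simpa [dualRelation] using congrFun hc (j - 3)
  rw [mul_comm, ← smul_eq_mul, ← smul_dotProduct, h, zero_dotProduct]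

variable (x)

/-- The differentials of the resolution with free modules `F_i` of rank `(twists i).length`. -/
def differentialMatrix :
    ∀ i, Matrix (Fin (twists i).length) (Fin (twists (i + 1)).length) R
  | 0 => Matrix.replicateRow (Fin 1) (minimalRelation x)
  | 1 => syzygyMatrix x
  | 2 => dualSyzygyMatrix x
  | 3 => Matrix.replicateCol (Fin 1) (dualRelation x)
  | _ + 4 => 0

/-- The linear map given by `differentialMatrix`. -/
abbrev differentialMap (i : ℕ) :
    (Fin (twists (i + 1)).length → R) →ₗ[R] (Fin (twists i).length → R) :=
  (differentialMatrix x i).mulVecLin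

lemma replicateCol_mulVec {m : Type*} (v : m → R) (z : Fin 1 → R) :
    Matrix.replicateCol (Fin 1) v *ᵥ z = z 0 • v := by
  ext j
  simp [Matrix.mulVec, dotProduct, mul_comm]

lemma differentialMap_differentialMap : ∀ (i : ℕ) (z : Fin (twists (i + 2)).length → R),
    differentialMap x i (differentialMap x (i + 1) z) = 0
  | 0, z => funext fun _ => by
    refine (Matrix.dotProduct_mulVec (minimalRelation x) (syzygyMatrix x) z).trans ?_
    rw [minimalRelation_vecMul]
    exact zero_dotProduct _
  | 1, z => syzygyMatrix_mulVec_dualSyzygyMatrix_mulVec x z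
  | 2, z => (congrArg (dualSyzygyMatrix x).mulVecLin (replicateCol_mulVec _ z)).trans <| by
      rw [map_smul, Matrix.mulVecLin_apply, dualSyzygyMatrix_mulVec_dualRelation]
      exact smul_zero _
  | 3, z => (congrArg (differentialMap x 3) (Matrix.zero_mulVec z)).trans (map_zero _)
  | i + 4, z => Matrix.zero_mulVec (differentialMap x (i + 5) z)

lemma smul_mem_range_differentialMap (a : Fin 9 → R) :
    ∀ (i : ℕ) (z : Fin (twists (i + 1)).length → R), differentialMap x i z = 0 →
      (minimalRelation x ⬝ᵥ a) • z ∈ LinearMap.range (differentialMap x (i + 1))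
  | 0, z, hz => exists_syzygyMatrix_mulVec_eq_smul (congrFun hz (0 : Fin 1))
  | 1, z, hz => exists_dualSyzygyMatrix_mulVec_eq_smul hz
  | 2, z, hz => by
    obtain ⟨y, hy⟩ := exists_smul_dualRelation_eq_smul (a := a) hz
    exact ⟨fun _ => y, (replicateCol_mulVec (dualRelation x) fun _ => y).trans hy⟩
  | 3, z, hz => ⟨0, funext fun j : Fin 1 => by
      obtain rfl : j = 0 := Subsingleton.elim _ _
      exact (mul_eq_zero_of_smul_dualRelation_eq_zero
        ((replicateCol_mulVec _ z).symm.trans hz)).symm⟩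
  | _ + 4, _, _ => ⟨0, funext fun j => Fin.elim0 j⟩

end Complex

section Exactness

section Variables

variable {σ : Type*} {K : Type*} [Field K]

lemma mem_ofList_map_X_iff [DecidableEq σ] (l : List σ) {f : MvPolynomial σ K} :
    f ∈ Ideal.ofList (l.map X) ↔ aeval (fun i => if i ∈ l then (0 : MvPolynomial σ K) else X i) f
      = 0 := by
  set φ : MvPolynomial σ K →ₐ[K] MvPolynomial σ K := aeval fun i => if i ∈ l then 0 else X i with hφ
  have mem_of_mem : ∀ i ∈ l, (X i : MvPolynomial σ K) ∈ Ideal.ofList (l.map X) :=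
    fun i hi => Ideal.subset_span (List.mem_map_of_mem hi)
  constructor <;> intro hf
  · refine (Ideal.span_le (I := RingHom.ker φ)).2 ?_ hf
    intro g hg
    obtain ⟨i, hi, rfl⟩ := List.mem_map.1 hg
    simp [hφ, hi]
  · have hcomp : (Ideal.Quotient.mkₐ K (Ideal.ofList (l.map X))).comp φ =
        Ideal.Quotient.mkₐ K (Ideal.ofList (l.map (X : σ → MvPolynomial σ K))) := by
      ext i
      by_cases hi : i ∈ l
      · simp [hφ, hi, Ideal.Quotient.eq_zero_iff_mem.2 (mem_of_mem i hi)]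
      · simp [hφ, hi]
    refine Ideal.Quotient.eq_zero_iff_mem.1 ((AlgHom.congr_fun hcomp f).symm.trans ?_)
    rw [AlgHom.comp_apply, hf, map_zero]

lemma isWeaklyRegular_map_X_append_singleton {l : List σ}
    (hl : IsWeaklyRegular (MvPolynomial σ K) (l.map (X : σ → MvPolynomial σ K)))
    {f : MvPolynomial σ K} {p : σ → K}
    (hp : ∀ i ∈ l, p i = 0) (hf : eval p f ≠ 0) :
    IsWeaklyRegular (MvPolynomial σ K) (l.map X ++ [f]) := by
  classical
  refine isWeaklyRegular_append_singleton_iff.2 ⟨hl, fun g hg => ?_⟩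
  rw [mem_ofList_map_X_iff] at hg ⊢
  rw [map_mul] at hg
  refine (mul_eq_zero.1 hg).resolve_left fun h => hf ?_
  refine (Ideal.span_le (I := RingHom.ker (eval p))).2 ?_ ((mem_ofList_map_X_iff l).2 h)
  intro g hg
  obtain ⟨i, hi, rfl⟩ := List.mem_map.1 hg
  simp [hp i hi]

end Variables

variable (K : Type u) [Field K]

/-- The variables, with the third one halved. -/
def halved : Fin 10 → PolyRing K :=
  ![X 0, X 1, C (1 / 2) * X 2, X 3, X 4, X 5, X 6, X 7, X 8, X 9]

/-- The ideal of relations, generated by the nine minimal ones. -/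
def relationIdeal : Ideal (PolyRing K) :=
  Ideal.span (Set.range (minimalRelation (halved K)))

variable {K}

lemma minimalRelation_mem (i : Fin 9) : minimalRelation (halved K) i ∈ relationIdeal K :=
  Ideal.subset_span ⟨i, rfl⟩

lemma mem_relationIdeal_iff {f : PolyRing K} :
    f ∈ relationIdeal K ↔ ∃ a, minimalRelation (halved K) ⬝ᵥ a = f := by
  simp only [relationIdeal, Ideal.mem_span_range_iff_exists_fun, dotProduct, mul_comm]

variable (K) in
lemma relation_castSucc (i : Fin 9) : relation K i.castSucc = minimalRelation (halved K) i := by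
  fin_cases i <;> simp [relation, minimalRelation, halved] <;> ring

variable (K) in
lemma relation_last : relation K (Fin.last 9) =
    X 0 * minimalRelation (halved K) 2 - X 7 * minimalRelation (halved K) 7 := by
  simp [relation, minimalRelation, halved, show Fin.last 9 = 9 from rfl]
  ring

variable (K) in
lemma span_relation : Ideal.span (Set.range (relation K)) = relationIdeal K := by
  refine le_antisymm (Ideal.span_le.2 ?_) (Ideal.span_le.2 ?_) <;> rintro _ ⟨i, rfl⟩
  · cases i using Fin.lastCases with
    | last =>
      rw [relation_last]
      exact sub_mem (Ideal.mul_mem_left _ _ (minimalRelation_mem 2))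
        (Ideal.mul_mem_left _ _ (minimalRelation_mem 7))
    | cast i => exact relation_castSucc K i ▸ minimalRelation_mem i
  · exact Ideal.subset_span ⟨i.castSucc, relation_castSucc K i⟩

variable (K) in
/-- A relation that does not involve `X 0`, `X 5` and `X 9`, the variables in which the minimal
relations `3`, `7` and `8` are monic. -/
def diagonalRelation : PolyRing K :=
  (X 1 * X 7 ^ 2 + X 3 * X 8 ^ 2 - X 6 * X 4 ^ 2) ^ 2 + C 4 * X 3 * X 6 * X 8 ^ 2 * X 4 ^ 2
    + C 4 * (C (1 / 2) * X 2) * X 8 ^ 2 * X 4 ^ 2 * X 7 ^ 2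

lemma diagonalRelation_mem : diagonalRelation K ∈ relationIdeal K := by
  set m := minimalRelation (halved K) with hm
  set e := -X 8 * m 2 - X 4 * m 0 + X 7 * m 1 with he
  have hemem : e ∈ relationIdeal K :=
    add_mem (sub_mem (Ideal.mul_mem_left _ _ (minimalRelation_mem 2))
      (Ideal.mul_mem_left _ _ (minimalRelation_mem 0)))
      (Ideal.mul_mem_left _ _ (minimalRelation_mem 1))
  have heq : diagonalRelation K = (e + C 4 * X 9 * X 8 * X 4) * e
      - C 4 * X 8 ^ 2 * X 4 ^ 2 * m 8 := by
    simp [he, hm, diagonalRelation, minimalRelation, halved, map_ofNat]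
    ring
  rw [heq]
  exact sub_mem (Ideal.mul_mem_left _ _ hemem) (Ideal.mul_mem_left _ _ (minimalRelation_mem 8))

variable (K) in
/-- Four relations that form a regular sequence, as many as the complex is long. -/
def regularRelations : List (PolyRing K) :=
  [diagonalRelation K, minimalRelation (halved K) 3, minimalRelation (halved K) 7,
    minimalRelation (halved K) 8]

lemma mem_relationIdeal_of_mem_regularRelations :
    ∀ f ∈ regularRelations K, f ∈ relationIdeal K := by
  simp [regularRelations, diagonalRelation_mem, minimalRelation_mem]

lemma minimalRelation_three :
    minimalRelation (halved K) 3 = (X 1 * X 6 - C (1 / 2) * X 2 * X 8 ^ 2) - X 5 ^ 2 :=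
  rfl

lemma minimalRelation_seven :
    minimalRelation (halved K) 7 = (-X 1 * X 3 - C (1 / 2) * X 2 * X 4 ^ 2) - X 0 ^ 2 := by
  simp [minimalRelation, halved]
  ring

lemma minimalRelation_eight :
    minimalRelation (halved K) 8 = (-(C (1 / 2) * X 2) * X 7 ^ 2 - X 3 * X 6) - X 9 ^ 2 :=
  rfl

lemma isWeaklyRegular_map_X_append_regularRelations {l : List (Fin 10)}
    (hl : IsWeaklyRegular (PolyRing K) (l.map (X : Fin 10 → PolyRing K))) {p : Fin 10 → K}
    (hp : ∀ i ∈ l, p i = 0) (hdiag : eval p (diagonalRelation K) ≠ 0)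
    (hfree : ∀ i ∈ l, i ∉ [0, 5, 9]) :
    IsWeaklyRegular (PolyRing K) (l.map X ++ regularRelations K) := by
  have isolate_of_mem : ∀ i ∈ [0, 5, 9], ∀ g ∈ l.map X ++ [diagonalRelation K],
      isolate i g = Polynomial.C g := by
    intro i hi g hg
    obtain hg | hg := List.mem_append.1 hg
    · obtain ⟨j, hj, rfl⟩ := List.mem_map.1 hg
      rw [isolate_X, if_neg fun h : j = i => hfree j hj (h ▸ hi)]
    · rw [List.mem_singleton.1 hg]
      simp only [List.mem_cons, List.not_mem_nil, or_false] at hi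
      obtain rfl | rfl | rfl := hi <;> simp [diagonalRelation, isolate_X]
  have h5 := isWeaklyRegular_append_sub_X_pow (i := 5) two_ne_zero
    (c := X 1 * X 6 - C (1 / 2) * X 2 * X 8 ^ 2)
    (List.forall_mem_cons.2 ⟨by simp [isolate_X], isolate_of_mem 5 (by simp)⟩)
    (isWeaklyRegular_map_X_append_singleton hl hp hdiag)
  have h0 := isWeaklyRegular_append_sub_X_pow (i := 0) two_ne_zero
    (c := -X 1 * X 3 - C (1 / 2) * X 2 * X 4 ^ 2)
    (List.forall_mem_cons.2 ⟨by simp [isolate_X], List.forall_mem_append.2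
      ⟨isolate_of_mem 0 (by simp), by simp [isolate_X]⟩⟩) h5
  have h9 := isWeaklyRegular_append_sub_X_pow (i := 9) two_ne_zero
    (c := -(C (1 / 2) * X 2) * X 7 ^ 2 - X 3 * X 6)
    (List.forall_mem_cons.2 ⟨by simp [isolate_X], List.forall_mem_append.2
      ⟨List.forall_mem_append.2 ⟨isolate_of_mem 9 (by simp), by simp [isolate_X]⟩,
        by simp [isolate_X]⟩⟩) h0
  rw [← minimalRelation_three, ← minimalRelation_seven, ← minimalRelation_eight] at h9
  simpa only [regularRelations, List.append_assoc, List.cons_append, List.nil_append] using h9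

lemma isWeaklyRegular_regularRelations :
    IsWeaklyRegular (PolyRing K) (regularRelations K) :=
  isWeaklyRegular_map_X_append_regularRelations (l := [])
    (p := ![0, 1, 0, 0, 0, 0, 0, 1, 0, 0]) (IsWeaklyRegular.nil _ _) (by simp)
    (by simp [diagonalRelation]) (by simp)

lemma isWeaklyRegular_X_seven : IsWeaklyRegular (PolyRing K) [(X 7 : PolyRing K)] :=
  isWeaklyRegular_map_X_append_singleton (l := []) (p := 1) (IsWeaklyRegular.nil _ _) (by simp)
    (by simp)

lemma isWeaklyRegular_X_seven_cons_regularRelations :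
    IsWeaklyRegular (PolyRing K) (X 7 :: regularRelations K) :=
  isWeaklyRegular_map_X_append_regularRelations (l := [7])
    (p := ![0, 0, 0, 1, 0, 0, 0, 0, 1, 0]) isWeaklyRegular_X_seven (by simp)
    (by simp [diagonalRelation]) (by simp)

lemma isWeaklyRegular_X_seven_cons_X_three_cons_regularRelations :
    IsWeaklyRegular (PolyRing K) (X 7 :: X 3 :: regularRelations K) :=
  isWeaklyRegular_map_X_append_regularRelations (l := [7, 3])
    (p := ![0, 0, 0, 0, 1, 0, 1, 0, 0, 0])
    (isWeaklyRegular_map_X_append_singleton (l := [7]) (f := X 3) (p := Pi.single 3 1)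
      isWeaklyRegular_X_seven (by simp) (by simp))
    (by simp) (by simp [diagonalRelation]) (by simp)

lemma subsingleton_of_four_lt (R : Type*) {i : ℕ} (hi : 4 < i) :
    Subsingleton (Fin (twists i).length → R) := by
  obtain ⟨j, rfl⟩ := Nat.exists_eq_add_of_lt hi
  rw [show 4 + j + 1 = j + 5 by lia]
  exact inferInstanceAs (Subsingleton (Fin 0 → R))

variable (K) in
/-- The differentials of the resolution of the algebra of invariants. -/
abbrev differential (i : ℕ) : FreeModule K (Fin 10) (twists (i + 1)) →ₗ[PolyRing K]
    FreeModule K (Fin 10) (twists i) :=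
  differentialMap (halved K) i

lemma smul_mem_range_differential {f : PolyRing K} (hf : f ∈ relationIdeal K) (i : ℕ)
    (z : FreeModule K (Fin 10) (twists (i + 1))) (hz : differential K i z = 0) :
    f • z ∈ LinearMap.range (differential K (i + 1)) := by
  obtain ⟨a, rfl⟩ := mem_relationIdeal_iff.1 hf
  exact smul_mem_range_differentialMap (halved K) a i z hz

theorem exact_differential (i : ℕ) : Exact (differential K (i + 1)) (differential K i) :=
  exact_of_forall_smul_mem_range (differentialMap_differentialMap (halved K))
    (fun _ => isWeaklyRegular_of_flat isWeaklyRegular_regularRelations _)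
    (fun _ => subsingleton_of_four_lt _)
    (fun f hf => smul_mem_range_differential (mem_relationIdeal_of_mem_regularRelations f hf)) i

lemma mem_range_differential_zero_iff {v : FreeModule K (Fin 10) (twists 0)} :
    v ∈ LinearMap.range (differential K 0) ↔ v (0 : Fin 1) ∈ relationIdeal K := by
  rw [mem_relationIdeal_iff]
  exact exists_congr fun a => ⟨fun h => congrFun h (0 : Fin 1), fun h => funext fun j : Fin 1 =>
    Subsingleton.elim 0 j ▸ h⟩

lemma mk_mem_range_map_differential_zero_iff {a : PolyRing K}
    {v : FreeModule K (Fin 10) (twists 0)} :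
    (Submodule.Quotient.mk v : QuotSMulTop a _) ∈
      LinearMap.range (QuotSMulTop.map a (differential K 0)) ↔
      v (0 : Fin 1) ∈ relationIdeal K ⊔ Ideal.span {a} := by
  rw [sup_comm, Ideal.mem_span_singleton_sup]
  constructor
  · rintro ⟨y, hy⟩
    obtain ⟨y, rfl⟩ := Submodule.Quotient.mk_surjective _ y
    rw [QuotSMulTop.map_apply_mk, eq_comm, Submodule.Quotient.eq] at hy
    obtain ⟨w, -, hw⟩ := hy
    refine ⟨w (0 : Fin 1), _, mem_range_differential_zero_iff.1 ⟨y, rfl⟩, ?_⟩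
    have := congrFun hw (0 : Fin 1)
    change a * w (0 : Fin 1) = v (0 : Fin 1) - differential K 0 y (0 : Fin 1) at this
    linear_combination this
  · rintro ⟨b, f, hf, h⟩
    obtain ⟨y, hy⟩ := (mem_range_differential_zero_iff (v := fun _ => f)).2 hf
    refine ⟨Submodule.Quotient.mk y, ?_⟩
    rw [QuotSMulTop.map_apply_mk, eq_comm, Submodule.Quotient.eq, hy]
    refine ⟨fun _ => b, trivial, funext fun j : Fin 1 => ?_⟩
    obtain rfl : j = 0 := Subsingleton.elim _ _
    change a * b = v (0 : Fin 1) - f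
    linear_combination h

lemma smul_mem_range_differential_zero {f : PolyRing K} (hf : f ∈ relationIdeal K)
    (z : FreeModule K (Fin 10) (twists 0)) : f • z ∈ LinearMap.range (differential K 0) :=
  mem_range_differential_zero_iff.2 (Ideal.mul_mem_right _ _ hf)

lemma isSMulRegular_X_seven :
    IsSMulRegular (FreeModule K (Fin 10) (twists 0) ⧸ LinearMap.range (differential K 0))
      (X 7 : PolyRing K) :=
  isSMulRegular_quotient_range exact_differential
    (fun _ => isWeaklyRegular_of_flat isWeaklyRegular_X_seven_cons_regularRelations _)
    (fun _ => subsingleton_of_four_lt _)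
    (fun f hf => smul_mem_range_differential_zero (mem_relationIdeal_of_mem_regularRelations f hf))

theorem mem_relationIdeal_of_X_seven_mul_mem {f : PolyRing K} (hf : X 7 * f ∈ relationIdeal K) :
    f ∈ relationIdeal K :=
  mem_range_differential_zero_iff.1 <|
    (isSMulRegular_quotient_iff_mem_of_smul_mem _ _).1 isSMulRegular_X_seven (fun _ => f)
      (mem_range_differential_zero_iff.2 hf)

theorem mem_relationIdeal_sup_of_X_three_mul_mem {f : PolyRing K}
    (hf : X 3 * f ∈ relationIdeal K ⊔ Ideal.span {X 7}) :
    f ∈ relationIdeal K ⊔ Ideal.span {X 7} := by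
  have hregular (i : ℕ) := (isWeaklyRegular_cons_iff _ _ _).1
    (isWeaklyRegular_of_flat (isWeaklyRegular_X_seven_cons_X_three_cons_regularRelations (K := K))
      (FreeModule K (Fin 10) (twists i)))
  have hann : ∀ g ∈ regularRelations K, ∀ z : QuotSMulTop (X 7 : PolyRing K) _,
      g • z ∈ LinearMap.range (QuotSMulTop.map (X 7) (differential K 0)) := by
    intro g hg z
    obtain ⟨z, rfl⟩ := Submodule.Quotient.mk_surjective _ z
    rw [← Submodule.Quotient.mk_smul, mk_mem_range_map_differential_zero_iff]
    exact Ideal.mem_sup_left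
      (Ideal.mul_mem_right _ _ (mem_relationIdeal_of_mem_regularRelations g hg))
  have hX := isSMulRegular_quotient_range
    (exact_quotSMulTop_map exact_differential (fun i => (hregular i).1) isSMulRegular_X_seven)
    (fun i => (hregular i).2)
    (fun i hi => have := subsingleton_of_four_lt (PolyRing K) hi; inferInstance) hann
  exact mk_mem_range_map_differential_zero_iff.1 <|
    (isSMulRegular_quotient_iff_mem_of_smul_mem _ _).1 hX (Submodule.Quotient.mk fun _ => f)
      (mk_mem_range_map_differential_zero_iff.2 hf)

end Exactness

section Elimination

variable {σ R : Type*}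

lemma exists_X_pow_mul_sub_mem [CommRing R] {J : Ideal (MvPolynomial σ R)} {T : Set σ} {j : σ}
    (hj : j ∉ T) (hT : ∀ i ∈ T, ∃ N, ∃ t ∈ supported R Tᶜ, X j ^ N * X i - t ∈ J)
    (F : MvPolynomial σ R) : ∃ N, ∃ t ∈ supported R Tᶜ, X j ^ N * F - t ∈ J := by
  have X_mem : ∀ i ∉ T, (X i : MvPolynomial σ R) ∈ supported R Tᶜ :=
    fun i hi => Algebra.subset_adjoin ⟨i, hi, rfl⟩
  induction F using MvPolynomial.induction_on with
  | C a => exact ⟨0, C a, Subalgebra.algebraMap_mem _ a, by simp⟩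
  | add F G hF hG =>
    obtain ⟨N, t, ht, hFt⟩ := hF
    obtain ⟨M, s, hs, hGs⟩ := hG
    refine ⟨N + M, X j ^ M * t + X j ^ N * s, add_mem (mul_mem (pow_mem (X_mem j hj) M) ht)
      (mul_mem (pow_mem (X_mem j hj) N) hs), ?_⟩
    convert add_mem (J.mul_mem_left (X j ^ M) hFt) (J.mul_mem_left (X j ^ N) hGs) using 1
    ring
  | mul_X F i hF =>
    obtain ⟨N, t, ht, hFt⟩ := hF
    obtain ⟨M, s, hs, hXs⟩ : ∃ M, ∃ s ∈ supported R Tᶜ, X j ^ M * X i - s ∈ J := by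
      by_cases hi : i ∈ T
      · exact hT i hi
      · exact ⟨0, X i, X_mem i hi, by simp⟩
    refine ⟨N + M, t * s, mul_mem ht hs, ?_⟩
    convert add_mem (J.mul_mem_left (X j ^ M * X i) hFt) (J.mul_mem_left t hXs) using 1
    ring

lemma eval_eq_of_mem_supported [CommRing R] {S : Set σ} {t : MvPolynomial σ R}
    (ht : t ∈ supported R S) {p q : σ → R} (h : ∀ i ∈ S, p i = q i) : eval p t = eval q t :=
  eval₂Hom_congr' rfl (fun i hi _ => h i (mem_supported.1 ht hi)) rfl

theorem mem_of_forall_eval_eq_zero [CommRing R] [IsDomain R] [Infinite R]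
    {J : Ideal (MvPolynomial σ R)} {T : Set σ} {j : σ} (hj : j ∉ T)
    (hT : ∀ i ∈ T, ∃ N, ∃ t ∈ supported R Tᶜ, X j ^ N * X i - t ∈ J)
    (hJ : ∀ F, X j * F ∈ J → F ∈ J) {s : (σ → R) → σ → R}
    (hs : ∀ l, l j ≠ 0 → ∀ i ∉ T, s l i = l i)
    (hsJ : ∀ l, l j ≠ 0 → ∀ G ∈ J, eval (s l) G = 0)
    {F : MvPolynomial σ R} (hF : ∀ l, l j ≠ 0 → eval (s l) F = 0) : F ∈ J := by
  obtain ⟨N, t, ht, hFt⟩ := exists_X_pow_mul_sub_mem hj hT F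
  have eval_t : ∀ l, l j ≠ 0 → eval l t = 0 := fun l hl => by
    have h := hsJ l hl _ hFt
    rw [map_sub, map_mul, hF l hl, mul_zero, zero_sub, neg_eq_zero] at h
    rwa [eval_eq_of_mem_supported ht (hs l hl)] at h
  have X_mul_t : X j * t = 0 := MvPolynomial.funext fun l => by
    by_cases hl : l j = 0
    · simp [hl]
    · simp [eval_t l hl]
  rw [(mul_eq_zero.1 X_mul_t).resolve_left (X_ne_zero j), sub_zero] at hFt
  clear ht X_mul_t eval_t
  induction N with
  | zero => simpa using hFt
  | succ N ih => exact ih (hJ _ (by rwa [← mul_assoc, ← pow_succ']))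

end Elimination

section Kernel

/-- The point of `3V₁ ⊕ V₂` with the given coordinates. -/
def point {α : Type*} (x₀ x₁ y₀ y₁ u₀ u₁ v₀ v₁ v₂ : α) : Coord → α
  | ⟨0, i⟩ => (![x₀, x₁] : Fin 2 → α) i
  | ⟨1, i⟩ => (![y₀, y₁] : Fin 2 → α) i
  | ⟨2, i⟩ => (![u₀, u₁] : Fin 2 → α) i
  | ⟨3, i⟩ => (![v₀, v₁, v₂] : Fin 3 → α) i

lemma forall_coord {P : Coord → Prop} : (∀ c, P c) ↔
    (P ⟨0, 0⟩ ∧ P ⟨0, 1⟩) ∧ (P ⟨1, 0⟩ ∧ P ⟨1, 1⟩) ∧ (P ⟨2, 0⟩ ∧ P ⟨2, 1⟩) ∧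
      P ⟨3, 0⟩ ∧ P ⟨3, 1⟩ ∧ P ⟨3, 2⟩ := by
  refine ⟨fun h => by simp only [h, and_self], ?_⟩
  rintro ⟨hx, hy, hu, hv⟩ ⟨j, i⟩
  fin_cases j
  exacts [(Fin.forall_fin_two (p := fun i => P ⟨0, i⟩)).2 hx i,
    (Fin.forall_fin_two (p := fun i => P ⟨1, i⟩)).2 hy i,
    (Fin.forall_fin_two (p := fun i => P ⟨2, i⟩)).2 hu i,
    (Fin.forall_fin_succ (P := fun i => P ⟨3, i⟩)).2 ⟨hv.1, Fin.forall_fin_two.2 hv.2⟩ i]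

variable {K : Type u} [Field K]

/-- The values of the ten generators at a point. -/
def generatorValues (p : Coord → K) (i : Fin 10) : K :=
  eval p (generator K i)

lemma eval_aeval_generator (p : Coord → K) (F : PolyRing K) :
    eval p (aeval (generator K) F) = eval (generatorValues p) F := by
  induction F using MvPolynomial.induction_on with
  | C a => simp
  | add p q hp hq => rw [map_add, map_add, map_add, hp, hq]
  | mul_X p i hp => rw [map_mul, map_mul, map_mul, hp, aeval_X, eval_X, generatorValues]

/-- The normal form of a point with generator values `l`, where `l 7 ≠ 0`: the first two vectors
are `(0, 1)` and `(l 7, 0)`. -/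
def normalPoint (l : Fin 10 → K) : Coord → K :=
  point 0 1 (l 7) 0 (l 4) (-l 8 / l 7) (-l 3) (-l 9 / l 7) (l 6 / l 7 ^ 2)

lemma generatorValues_normalPoint {l : Fin 10 → K} (hl : l 7 ≠ 0) {i : Fin 10}
    (hi : i ∉ ({0, 1, 2, 5} : Set (Fin 10))) : generatorValues (normalPoint l) i = l i := by
  fin_cases i <;> simp at hi <;> simp [generatorValues, generator, normalPoint, point] <;>
    field_simp

/-- A point with generator values `l` whose first two vectors are linearly dependent, so that
`l 7 = 0`, where `l 3 ≠ 0`. -/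
def degeneratePoint (l : Fin 10 → K) : Coord → K :=
  point 1 0 (-l 9 / l 3) 0 (-l 0 / l 3) (-l 4) (-l 2 / (2 * l 3)) 0 (-l 3)

lemma generatorValues_degeneratePoint_seven (l : Fin 10 → K) :
    generatorValues (degeneratePoint l) 7 = 0 := by
  simp [generatorValues, generator, degeneratePoint, point]

lemma exists_X_three_pow_mul_X_sub_mem {i : Fin 10}
    (hi : i ∈ ({1, 5, 6, 7, 8} : Set (Fin 10))) :
    ∃ N, ∃ t ∈ supported K ({1, 5, 6, 7, 8} : Set (Fin 10))ᶜ,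
      X 3 ^ N * X i - t ∈ relationIdeal K ⊔ Ideal.span {X 7} := by
  have h (i : Fin 9) : minimalRelation (halved K) i ∈ relationIdeal K ⊔ Ideal.span {X 7} :=
    Ideal.mem_sup_left (minimalRelation_mem i)
  have mul_X_mem (f : PolyRing K) : f * X 7 ∈ relationIdeal K ⊔ Ideal.span {X 7} :=
    Ideal.mem_sup_right (Ideal.mul_mem_left _ _ (Ideal.mem_span_singleton_self _))
  have X_mem (i : Fin 10) (hi : i ∉ ({1, 5, 6, 7, 8} : Set (Fin 10))) :
      X i ∈ supported K ({1, 5, 6, 7, 8} : Set (Fin 10))ᶜ := X_mem_supported.2 hi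
  have h0 := X_mem 0 (by simp)
  have h2 := X_mem 2 (by simp)
  have h4 := X_mem 4 (by simp)
  have h9 := X_mem 9 (by simp)
  obtain rfl | rfl | rfl | rfl | rfl := hi
  · refine ⟨1, _, sub_mem (neg_mem (mul_mem h0 h0))
      (Subalgebra.smul_mem _ (mul_mem h2 (mul_mem h4 h4)) (1 / 2 : K)), ?_⟩
    convert neg_mem (h 7) using 1
    simp [minimalRelation, halved, smul_eq_C_mul]
    ring
  · refine ⟨1, _, neg_mem (mul_mem h0 h9), ?_⟩
    convert sub_mem (neg_mem (h 4)) (mul_X_mem (C (1 / 2) * X 2 * X 4)) using 1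
    simp [minimalRelation, halved]
    ring
  · refine ⟨1, _, neg_mem (mul_mem h9 h9), ?_⟩
    convert sub_mem (neg_mem (h 8)) (mul_X_mem (C (1 / 2) * X 2 * X 7)) using 1
    simp [minimalRelation, halved]
    ring
  · exact ⟨0, 0, zero_mem _, by simpa using mul_X_mem 1⟩
  · refine ⟨1, _, neg_mem (mul_mem h4 h9), ?_⟩
    convert add_mem (h 2) (mul_X_mem (X 0)) using 1
    simp [minimalRelation, halved]
    ring

variable [CharZero K]

lemma generatorValues_degeneratePoint {l : Fin 10 → K} (hl : l 3 ≠ 0) {i : Fin 10}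
    (hi : i ∉ ({1, 5, 6, 7, 8} : Set (Fin 10))) :
    generatorValues (degeneratePoint l) i = l i := by
  fin_cases i <;> simp at hi <;> simp [generatorValues, generator, degeneratePoint, point] <;>
    field_simp

lemma aeval_generator_minimalRelation (i : Fin 9) :
    aeval (generator K) (minimalRelation (halved K) i) = 0 := by
  refine MvPolynomial.funext fun p => ?_
  rw [eval_aeval_generator]
  fin_cases i <;> simp [minimalRelation, halved, generatorValues, generator] <;> ring

lemma aeval_generator_eq_zero {F : PolyRing K} (hF : F ∈ relationIdeal K) :
    aeval (generator K) F = 0 := by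
  refine (Ideal.span_le (I := RingHom.ker (aeval (generator K)))).2 ?_ hF
  rintro _ ⟨i, rfl⟩
  exact aeval_generator_minimalRelation i

lemma eval_generatorValues_eq_zero (p : Coord → K) {F : PolyRing K} (hF : F ∈ relationIdeal K) :
    eval (generatorValues p) F = 0 := by
  rw [← eval_aeval_generator, aeval_generator_eq_zero hF, map_zero]

lemma exists_X_seven_pow_mul_X_sub_mem {i : Fin 10} (hi : i ∈ ({0, 1, 2, 5} : Set (Fin 10))) :
    ∃ N, ∃ t ∈ supported K ({0, 1, 2, 5} : Set (Fin 10))ᶜ,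
      X 7 ^ N * X i - t ∈ relationIdeal K := by
  have h := minimalRelation_mem (K := K)
  have X_mem (i : Fin 10) (hi : i ∉ ({0, 1, 2, 5} : Set (Fin 10))) :
      X i ∈ supported K ({0, 1, 2, 5} : Set (Fin 10))ᶜ := X_mem_supported.2 hi
  have h3 := X_mem 3 (by simp)
  have h4 := X_mem 4 (by simp)
  have h6 := X_mem 6 (by simp)
  have h8 := X_mem 8 (by simp)
  have h9 := X_mem 9 (by simp)
  have mem_zero := add_mem (mul_mem h3 h8) (mul_mem h4 h9)
  have mem_five := sub_mem (mul_mem h4 h6) (mul_mem h8 h9)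
  obtain rfl | rfl | rfl | rfl := hi
  · refine ⟨1, _, mem_zero, ?_⟩
    convert neg_mem (h 2) using 1
    simp [minimalRelation, halved]
    ring
  · refine ⟨2, _, sub_mem (mul_mem h4 mem_five) (mul_mem h8 mem_zero), ?_⟩
    convert sub_mem (add_mem (Ideal.mul_mem_left _ (X 4) (h 0))
      (Ideal.mul_mem_left _ (X 8) (h 2))) (Ideal.mul_mem_left _ (X 7) (h 1)) using 1
    simp [minimalRelation, halved]
    ring
  · refine ⟨2, _, Subalgebra.smul_mem _ (add_mem (mul_mem h3 h6) (mul_mem h9 h9)) (-2 : K), ?_⟩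
    have two_mul_half : (C 2 * C (1 / 2) : PolyRing K) = 1 := by simp [← C_mul]
    convert Ideal.mul_mem_left _ (C (-2)) (h 8) using 1
    simp only [minimalRelation, halved, Matrix.cons_val, smul_eq_C_mul, map_neg]
    linear_combination -X 7 ^ 2 * X 2 * two_mul_half
  · refine ⟨1, _, mem_five, ?_⟩
    convert h 0 using 1
    simp [minimalRelation, halved]
    ring

theorem mem_relationIdeal_of_aeval_generator_eq_zero {F : PolyRing K}
    (hF : aeval (generator K) F = 0) : F ∈ relationIdeal K :=
  mem_of_forall_eval_eq_zero (s := fun l => generatorValues (normalPoint l)) (by simp)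
    (fun _ => exists_X_seven_pow_mul_X_sub_mem) (fun _ => mem_relationIdeal_of_X_seven_mul_mem)
    (fun _ hl _ => generatorValues_normalPoint hl) (fun _ _ _ => eval_generatorValues_eq_zero _)
    (fun l _ => by rw [← eval_aeval_generator, hF, map_zero])

lemma presentation_coe (F : PolyRing K) :
    (presentation K F : MvPolynomial Coord K) = aeval (generator K) F := by
  have : (invariantAlgebra K).val.comp (presentation K) = aeval (generator K) := by
    ext1 i
    simp [presentation]
  exact DFunLike.congr_fun this F

theorem ker_presentation : RingHom.ker (presentation K) = relationIdeal K := by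
  ext F
  rw [RingHom.mem_ker, ← Subtype.coe_inj, presentation_coe]
  exact ⟨mem_relationIdeal_of_aeval_generator_eq_zero, aeval_generator_eq_zero⟩

theorem mem_of_generator_seven_dvd {F : PolyRing K}
    (hF : generator K 7 ∣ aeval (generator K) F) : F ∈ relationIdeal K ⊔ Ideal.span {X 7} := by
  have eval_eq_zero (l : Fin 10 → K) {G : PolyRing K}
      (hG : generator K 7 ∣ aeval (generator K) G) :
      eval (generatorValues (degeneratePoint l)) G = 0 := by
    obtain ⟨f, hf⟩ := hG
    rw [← eval_aeval_generator, hf, map_mul, ← generatorValues,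
      generatorValues_degeneratePoint_seven, zero_mul]
  refine mem_of_forall_eval_eq_zero (s := fun l => generatorValues (degeneratePoint l)) (by simp)
    (fun _ => exists_X_three_pow_mul_X_sub_mem)
    (fun _ => mem_relationIdeal_sup_of_X_three_mul_mem)
    (fun _ hl _ => generatorValues_degeneratePoint hl) (fun l _ G hG => ?_)
    (fun l _ => eval_eq_zero l hF)
  obtain ⟨J, hJ, a, ha, rfl⟩ := Submodule.mem_sup.1 hG
  obtain ⟨b, rfl⟩ := Ideal.mem_span_singleton.1 ha
  exact eval_eq_zero l ⟨aeval (generator K) b, by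
    rw [map_add, aeval_generator_eq_zero hJ, zero_add, map_mul, aeval_X]⟩

end Kernel

section Generation

lemma exists_coordinate_eq {K : Type*} [Field K] [CharZero K] {d : ℕ} (a : Fin (d + 1) → K) :
    ∃ F : BinaryForm K d, ∀ i, coordinate F i = a i := by
  refine ⟨⟨∑ i : Fin (d + 1), monomial (Finsupp.single 0 (d - i) + Finsupp.single 1 (i : ℕ))
    ((d.choose i : K) * a i), sum_mem fun i _ => ?_⟩, fun i => ?_⟩
  · rw [mem_homogeneousSubmodule]
    refine isHomogeneous_monomial _ ?_
    rw [map_add, Finsupp.degree_single, Finsupp.degree_single]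
    lia
  · have choose_ne_zero : ((d.choose i : ℕ) : K) ≠ 0 :=
      Nat.cast_ne_zero.2 (Nat.choose_pos (Nat.lt_succ_iff.1 i.2)).ne'
    rw [coordinate, coeff_sum, Finset.sum_eq_single i]
    · rw [coeff_monomial, if_pos rfl, inv_mul_cancel_left₀ choose_ne_zero]
    · intro j _ hj
      rw [coeff_monomial, if_neg fun h => hj (Fin.ext (by simpa using DFunLike.congr_fun h 1))]
    · simp

lemma exists_coordinates_eq {K : Type*} [Field K] [CharZero K] {n : ℕ} {d : Fin n → ℕ}
    (p : (Σ j : Fin n, Fin (d j + 1)) → K) :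
    ∃ F : ∀ j, BinaryForm K (d j), coordinates F = p := by
  choose F hF using fun j => exists_coordinate_eq fun i => p ⟨j, i⟩
  exact ⟨F, funext fun c => hF c.1 c.2⟩

variable {K : Type u} [Field K]

variable (K) in
/-- The coordinates of the normal form, as polynomials in the generator values after multiplication
by `l 7 ^ 2`. -/
def clearedNormalPoint : Coord → PolyRing K :=
  point 0 (X 7 ^ 2) (X 7 ^ 3) 0 (X 7 ^ 2 * X 4) (-(X 7 * X 8)) (-(X 7 ^ 2 * X 3)) (-(X 7 * X 9))
    (X 6)

lemma eval_clearedNormalPoint {l : Fin 10 → K} (hl : l 7 ≠ 0) (c : Coord) :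
    eval l (clearedNormalPoint K c) = l 7 ^ 2 * normalPoint l c := by
  revert c
  refine forall_coord.2 ⟨⟨?_, ?_⟩, ⟨?_, ?_⟩, ⟨?_, ?_⟩, ?_, ?_, ?_⟩ <;>
    simp [clearedNormalPoint, normalPoint, point] <;> field_simp

/-- The action of `SL₂(K)` on `3V₁ ⊕ V₂` in coordinates. -/
def act (g : SL(2, K)) (p : Coord → K) : Coord → K :=
  let v (j : Fin 4) (i : Fin (degs j + 1)) : K := p ⟨j, i⟩
  point (g.1 0 0 * v 0 0 + g.1 0 1 * v 0 1) (g.1 1 0 * v 0 0 + g.1 1 1 * v 0 1)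
    (g.1 0 0 * v 1 0 + g.1 0 1 * v 1 1) (g.1 1 0 * v 1 0 + g.1 1 1 * v 1 1)
    (g.1 0 0 * v 2 0 + g.1 0 1 * v 2 1) (g.1 1 0 * v 2 0 + g.1 1 1 * v 2 1)
    (g.1 0 0 ^ 2 * v 3 0 + 2 * g.1 0 0 * g.1 0 1 * v 3 1 + g.1 0 1 ^ 2 * v 3 2)
    (g.1 0 0 * g.1 1 0 * v 3 0 + (g.1 0 0 * g.1 1 1 + g.1 0 1 * g.1 1 0) * v 3 1
      + g.1 0 1 * g.1 1 1 * v 3 2)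
    (g.1 1 0 ^ 2 * v 3 0 + 2 * g.1 1 0 * g.1 1 1 * v 3 1 + g.1 1 1 ^ 2 * v 3 2)

lemma exists_eval_normalPoint (f : MvPolynomial Coord K) : ∃ (N : ℕ) (G : PolyRing K),
    ∀ {l : Fin 10 → K}, l 7 ≠ 0 → l 7 ^ N * eval (normalPoint l) f = eval l G := by
  induction f using MvPolynomial.induction_on with
  | C a => exact ⟨0, C a, by simp⟩
  | add p q hp hq =>
    obtain ⟨N, G, hG⟩ := hp
    obtain ⟨M, H, hH⟩ := hq
    refine ⟨N + M, X 7 ^ M * G + X 7 ^ N * H, fun hl => ?_⟩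
    simp only [map_add, map_mul, map_pow, eval_X, ← hG hl, ← hH hl]
    ring
  | mul_X p c hp =>
    obtain ⟨N, G, hG⟩ := hp
    refine ⟨N + 2, G * clearedNormalPoint K c, fun {l} hl => ?_⟩
    rw [map_mul, map_mul, ← hG hl, eval_clearedNormalPoint hl, eval_X]
    ring

lemma exists_act_eq_normalPoint {p : Coord → K} (hp : generatorValues p 7 ≠ 0) :
    ∃ g : SL(2, K), act g p = normalPoint (generatorValues p) := by
  set x₀ := p ⟨0, 0⟩
  set x₁ := p ⟨0, 1⟩
  set y₀ := p ⟨1, 0⟩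
  set y₁ := p ⟨1, 1⟩
  obtain ⟨d, hd⟩ : ∃ d, generatorValues p 7 = d := ⟨_, rfl⟩
  have hd' : -x₀ * y₁ + x₁ * y₀ = d := by simp [← hd, generatorValues, generator, x₀, x₁, y₀, y₁]
  rw [hd] at hp
  refine ⟨⟨!![x₁, -x₀; -y₁ / d, y₀ / d], ?_⟩, ?_⟩
  · rw [Matrix.det_fin_two_of]
    field_simp
    linear_combination hd'
  · rw [normalPoint, hd]
    simp only [act, generatorValues, generator]
    congr 1 <;> simp <;> field_simp <;>
      first | ring1 | linear_combination hd'

lemma constantCoeff_pderiv_eq_zero {F : PolyRing K} (hF : F ∈ relationIdeal K) (i : Fin 10) :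
    constantCoeff (pderiv i F) = 0 := by
  suffices h : constantCoeff F = 0 ∧ constantCoeff (pderiv i F) = 0 from h.2
  induction hF using Submodule.span_induction with
  | mem F hF =>
    obtain ⟨j, rfl⟩ := hF
    fin_cases j <;> simp [minimalRelation, halved]
  | zero => simp
  | add F G _ _ hF hG => simp [hF, hG]
  | smul F G _ hG => simp [hG]

variable [CharZero K]

lemma coordinates_binaryFormRep (g : SL(2, K)) (F : ∀ j, BinaryForm K (degs j)) :
    coordinates (fun j => binaryFormRep K (degs j) g (F j)) = act g (coordinates F) := by
  have linear (F : BinaryForm K 1) := coordinate_linear F g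
  have quadratic (F : BinaryForm K 2) := coordinate_quadratic F g
  exact funext <| forall_coord.2 ⟨linear (F 0), linear (F 1), linear (F 2), quadratic (F 3)⟩

lemma eval_act {f : MvPolynomial Coord K} (hf : f ∈ invariantAlgebra K) (g : SL(2, K))
    (p : Coord → K) : eval (act g p) f = eval p f := by
  obtain ⟨F, rfl⟩ := exists_coordinates_eq p
  rw [← coordinates_binaryFormRep, hf g F]

lemma eval_normalPoint {f : MvPolynomial Coord K} (hf : f ∈ invariantAlgebra K) {p : Coord → K}
    (hp : generatorValues p 7 ≠ 0) : eval (normalPoint (generatorValues p)) f = eval p f := by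
  obtain ⟨g, hg⟩ := exists_act_eq_normalPoint hp
  rw [← hg, eval_act hf]

theorem exists_aeval_generator_eq {f : MvPolynomial Coord K} (hf : f ∈ invariantAlgebra K) :
    ∃ F : PolyRing K, aeval (generator K) F = f := by
  have generator_ne_zero : generator K 7 ≠ 0 := fun h => by
    have := generatorValues_normalPoint (K := K) (l := 1) one_ne_zero (i := 7) (by simp)
    simp [generatorValues, h] at this
  obtain ⟨N, G, hG⟩ := exists_eval_normalPoint f
  have hGf : aeval (generator K) G = generator K 7 ^ N * f := by
    refine mul_left_cancel₀ generator_ne_zero (MvPolynomial.funext fun p => ?_)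
    rw [map_mul, map_mul, ← generatorValues]
    by_cases hp : generatorValues p 7 = 0
    · rw [hp, zero_mul, zero_mul]
    · rw [eval_aeval_generator, ← hG hp, eval_normalPoint hf hp, map_mul, map_pow, generatorValues]
  clear hG
  induction N generalizing G with
  | zero => exact ⟨G, by rw [hGf, pow_zero, one_mul]⟩
  | succ N ih =>
    rw [pow_succ', mul_assoc] at hGf
    obtain ⟨J, hJ, a, ha, rfl⟩ := Submodule.mem_sup.1 (mem_of_generator_seven_dvd ⟨_, hGf⟩)
    obtain ⟨F, rfl⟩ := Ideal.mem_span_singleton.1 ha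
    rw [map_add, aeval_generator_eq_zero hJ, zero_add, map_mul, aeval_X] at hGf
    exact ih F (mul_left_cancel₀ generator_ne_zero hGf)

theorem adjoin_generator : Algebra.adjoin K (Set.range (generator K)) = invariantAlgebra K := by
  rw [Algebra.adjoin_range_eq_range_aeval]
  refine le_antisymm ?_ fun f hf => exists_aeval_generator_eq hf
  rintro _ ⟨F, rfl⟩
  exact presentation_coe F ▸ (presentation K F).2

lemma presentation_surjective : Function.Surjective (presentation K) := fun f => by
  obtain ⟨F, hF⟩ := exists_aeval_generator_eq f.2
  exact ⟨F, Subtype.ext ((presentation_coe F).trans hF)⟩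

theorem adjoin_generator_image_compl_ne (i : Fin 10) :
    Algebra.adjoin K (generator K '' {i}ᶜ) ≠ invariantAlgebra K := fun h => by
  have adjoin_eq_map : Algebra.adjoin K (generator K '' {i}ᶜ) =
      (supported K {i}ᶜ).map (aeval (generator K)) := by
    rw [supported, AlgHom.map_adjoin, Set.image_image]
    simp only [aeval_X]
  obtain ⟨F, hF, hFi⟩ := adjoin_eq_map ▸ h ▸ generator_mem K i
  have hX : X i - F ∈ relationIdeal K := mem_relationIdeal_of_aeval_generator_eq_zero <| by
    rw [map_sub, aeval_X, sub_eq_zero]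
    exact hFi.symm
  have hpderiv : pderiv i F = 0 :=
    pderiv_eq_zero_of_notMem_vars fun hi => mem_supported.1 hF hi rfl
  simpa [hpderiv] using constantCoeff_pderiv_eq_zero hX i

end Generation

section Homogeneity

lemma isWeightedHomogeneous_aeval {σ τ K M : Type*} [CommSemiring K] [AddCommMonoid M]
    {w : σ → M} {u : τ → M} {g : σ → MvPolynomial τ K}
    (hg : ∀ i, IsWeightedHomogeneous u (g i) (w i)) {f : MvPolynomial σ K} {n : M}
    (hf : IsWeightedHomogeneous w f n) :
    IsWeightedHomogeneous u (aeval g f) n := by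
  rw [aeval_def, eval₂_eq]
  refine IsWeightedHomogeneous.sum _ _ _ fun m hm => IsWeightedHomogeneous.C_mul ?_ _
  rw [← hf (mem_support_iff.1 hm), Finsupp.weight_apply]
  exact IsWeightedHomogeneous.prod _ _ _ fun i _ => (hg i).pow _

lemma generator_isHomogeneous {K : Type u} [Field K] (i : Fin 10) :
    (generator K i).IsHomogeneous (weight i) := by
  have var (c) : (X c : MvPolynomial Coord K).IsHomogeneous 1 := isHomogeneous_X K c
  have two : (2 : MvPolynomial Coord K).IsHomogeneous 0 := isHomogeneous_C Coord (2 : K)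
  have sq (c) : (X c ^ 2 : MvPolynomial Coord K).IsHomogeneous 2 := (var c).pow 2
  have cubic (c c' c'') : (X c * X c' * X c'' : MvPolynomial Coord K).IsHomogeneous 3 :=
    ((var c).mul (var c')).mul (var c'')
  have sq_mul (c c') : (X c ^ 2 * X c' : MvPolynomial Coord K).IsHomogeneous 3 :=
    (sq c).mul (var c')
  have two_cubic (c c' c'') : (2 * X c * X c' * X c'' : MvPolynomial Coord K).IsHomogeneous 3 :=
    ((two.mul (var c)).mul (var c')).mul (var c'')
  have bracket (a b c d) : (-X a * X b + X c * X d : MvPolynomial Coord K).IsHomogeneous 2 :=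
    ((var a).neg.mul (var b)).add ((var c).mul (var d))
  fin_cases i
  · exact (((((var _).neg.mul (var _)).mul (var _)).add (cubic _ _ _)).sub (cubic _ _ _)).add
      (cubic _ _ _)
  · exact ((((two.neg.mul (var _)).mul (var _)).mul (var _)).add (sq_mul _ _)).add (sq_mul _ _)
  · exact (two.neg.mul (sq _)).add ((two.mul (var _)).mul (var _))
  · exact (((sq _).neg.mul (var _)).sub (sq_mul _ _)).add (two_cubic _ _ _)
  · exact bracket _ _ _ _
  · exact (((cubic _ _ _).sub (cubic _ _ _)).sub (cubic _ _ _)).add (cubic _ _ _)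
  · exact ((sq_mul _ _).sub (two_cubic _ _ _)).add (sq_mul _ _)
  · exact bracket _ _ _ _
  · exact bracket _ _ _ _
  · exact (((cubic _ _ _).sub (cubic _ _ _)).sub (cubic _ _ _)).add (cubic _ _ _)

variable {R S : Type*} [CommRing R] [SetLike S R] [AddSubgroupClass S R] {𝒜 : ℕ → S}
  [SetLike.GradedMonoid 𝒜] {x : Fin 10 → R}

lemma minimalRelation_mem_graded (hx : ∀ i, x i ∈ 𝒜 (weight i)) (j : Fin 9) :
    minimalRelation x j ∈ 𝒜 ((twists 1).get j) := by
  have mul (i j) : x i * x j ∈ 𝒜 (weight i + weight j) := SetLike.mul_mem_graded (hx i) (hx j)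
  have neg_mul (i j) : -x i * x j ∈ 𝒜 (weight i + weight j) :=
    SetLike.mul_mem_graded (neg_mem (hx i)) (hx j)
  have mul_mul (i j k) : x i * x j * x k ∈ 𝒜 (weight i + weight j + weight k) :=
    SetLike.mul_mem_graded (mul i j) (hx k)
  have sq (i) : x i ^ 2 ∈ 𝒜 (2 * weight i) := SetLike.pow_mem_graded 2 (hx i)
  have mul_sq (i j) : x i * x j ^ 2 ∈ 𝒜 (weight i + 2 * weight j) :=
    SetLike.mul_mem_graded (hx i) (sq j)
  have neg_mul_sq (i j) : -x i * x j ^ 2 ∈ 𝒜 (weight i + 2 * weight j) :=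
    SetLike.mul_mem_graded (neg_mem (hx i)) (sq j)
  fin_cases j
  · exact add_mem (add_mem (neg_mul 4 6) (mul 5 7)) (mul 8 9)
  · exact add_mem (sub_mem (neg_mul 0 8) (mul 1 7)) (mul 4 5)
  · exact add_mem (add_mem (neg_mul 0 7) (mul 3 8)) (mul 4 9)
  · exact sub_mem (sub_mem (mul 1 6) (mul_sq 2 8)) (sq 5)
  · exact sub_mem (sub_mem (neg_mul 0 9) (mul_mul 2 4 7)) (mul 3 5)
  · exact sub_mem (add_mem (neg_mul 0 5) (mul 1 9)) (mul_mul 2 4 8)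
  · exact add_mem (sub_mem (neg_mul 0 6) (mul_mul 2 7 8)) (mul 5 9)
  · exact sub_mem (sub_mem (neg_mem (sq 0)) (mul 1 3)) (mul_sq 2 4)
  · exact sub_mem (sub_mem (neg_mul_sq 2 7) (mul 3 6)) (sq 9)

lemma syzygyMatrix_mem_graded (hx : ∀ i, x i ∈ 𝒜 (weight i)) (i : Fin 9) (j : Fin 16) :
    syzygyMatrix x i j ∈ 𝒜 ((twists 2).get j - (twists 1).get i) := by
  have of_terms (P : R → ℕ → Prop) (zero : ∀ n, P 0 n) (var : ∀ i, P (x i) (weight i))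
      (neg : ∀ i, P (-x i) (weight i)) (mul : ∀ i j, P (x i * x j) (weight i + weight j))
      (neg_mul : ∀ i j, P (-x i * x j) (weight i + weight j)) :
      P (syzygyMatrix x i j) ((twists 2).get j - (twists 1).get i) := by
    fin_cases i <;> fin_cases j <;>
      first | exact zero _ | exact var _ | exact neg _ | exact mul _ _ | exact neg_mul _ _
  exact of_terms (fun f n => f ∈ 𝒜 n) (fun n => zero_mem (𝒜 n)) hx (fun i => neg_mem (hx i))
    (fun i j => SetLike.mul_mem_graded (hx i) (hx j))
    fun i j => SetLike.mul_mem_graded (neg_mem (hx i)) (hx j)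

end Homogeneity

section MinimalResolution

/-- A matrix that defines a homogeneous map of degree zero, with no unit among its entries, from the
graded free module with twists `t` to the one with twists `s`. The entry `A i j` has degree
`t j - s i`, which is required to be positive, so the subtraction is not truncated. -/
def IsMinimalGradedMatrix {K σ : Type*} [CommSemiring K] (w : σ → ℕ) (s t : List ℕ)
    (A : Matrix (Fin s.length) (Fin t.length) (MvPolynomial σ K)) : Prop :=
  ∀ i j, s.get i < t.get j ∧ IsWeightedHomogeneous w (A i j) (t.get j - s.get i)

lemma get_twists_lt_get_twists : ∀ (k : Fin 4) (i : Fin (twists k).length)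
    (j : Fin (twists (k + 1)).length), (twists k).get i < (twists (k + 1)).get j := by
  decide

attribute [local instance] WeightedHomogeneousSubmodule.gradedMonoid in
lemma isMinimalGradedMatrix_differentialMatrix {σ K : Type*} [CommRing K] {w : σ → ℕ}
    {x : Fin 10 → MvPolynomial σ K} (hx : ∀ i, IsWeightedHomogeneous w (x i) (weight i)) :
    ∀ k, IsMinimalGradedMatrix w (twists k) (twists (k + 1)) (differentialMatrix x k)
  | 0, i, j => by
    refine ⟨get_twists_lt_get_twists 0 i j, ?_⟩
    obtain rfl : i = (0 : Fin 1) := Subsingleton.elim (α := Fin 1) _ _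
    exact minimalRelation_mem_graded (𝒜 := weightedHomogeneousSubmodule K w) hx j
  | 1, i, j => ⟨get_twists_lt_get_twists 1 i j,
    syzygyMatrix_mem_graded (𝒜 := weightedHomogeneousSubmodule K w) hx i j⟩
  | 2, (i : Fin 16), (j : Fin 9) => by
    have hij : (twists 2).get (i + 8 : Fin 16) - (twists 1).get (j + 3 : Fin 9) =
        (twists 3).get j - (twists 2).get i := by revert i j; decide
    exact ⟨get_twists_lt_get_twists 2 i j,
      hij ▸ syzygyMatrix_mem_graded (𝒜 := weightedHomogeneousSubmodule K w) hx (j + 3 : Fin 9)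
        (i + 8 : Fin 16)⟩
  | 3, (i : Fin 9), (j : Fin 1) => by
    have hij : (twists 1).get (i + 3 : Fin 9) = (twists 4).get j - (twists 3).get i := by
      revert i j; decide
    exact ⟨get_twists_lt_get_twists 3 i j,
      hij ▸ minimalRelation_mem_graded (𝒜 := weightedHomogeneousSubmodule K w) hx (i + 3 : Fin 9)⟩
  | _ + 4, _, j => Fin.elim0 j

variable {K : Type u} [Field K]

section Graded

variable {σ : Type} {w : σ → ℕ} {s t : List ℕ}
  {A : Matrix (Fin s.length) (Fin t.length) (MvPolynomial σ K)}

lemma mem_irrelevantIdeal_iff {f : MvPolynomial σ K} :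
    f ∈ irrelevantIdeal K σ ↔ constantCoeff f = 0 := by
  rw [irrelevantIdeal, ← pow_one (Ideal.span _), mem_pow_idealOfVars_iff']
  simp [constantCoeff_eq, Finsupp.degree_eq_zero_iff]

lemma mul_mem_twistPiece {a b n : ℕ} (hab : a ≤ b) {f g : MvPolynomial σ K}
    (hf : IsWeightedHomogeneous w f (b - a)) (hg : g ∈ twistPiece w b n) :
    f * g ∈ twistPiece w a n := by
  by_cases hbn : b ≤ n
  · rw [twistPiece, if_pos hbn] at hg
    rw [twistPiece, if_pos (hab.trans hbn), mem_weightedHomogeneousSubmodule,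
      show n - a = b - a + (n - b) by omega]
    exact hf.mul hg
  · rw [twistPiece, if_neg hbn, Submodule.mem_bot] at hg
    rw [hg, mul_zero]
    exact zero_mem _

lemma IsMinimalGradedMatrix.mulVec_mem_freePiece (hA : IsMinimalGradedMatrix w s t A) {n : ℕ}
    {v : FreeModule K σ t} (hv : v ∈ freePiece w t n) : A *ᵥ v ∈ freePiece w s n := by
  intro i _
  change ∑ j, A i j * v j ∈ twistPiece w (s.get i) n
  exact sum_mem fun j _ => mul_mem_twistPiece (hA i j).1.le (hA i j).2 (hv j (Set.mem_univ j))

lemma IsMinimalGradedMatrix.mem_irrelevantIdeal (hA : IsMinimalGradedMatrix w s t A) (i) (j) :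
    A i j ∈ irrelevantIdeal K σ := by
  obtain ⟨hlt, hA⟩ := hA i j
  refine mem_irrelevantIdeal_iff.2 (hA.coeff_eq_zero 0 ?_)
  rw [map_zero]
  omega

lemma range_mulVecLin_le_smul_top {m n R : Type*} [CommRing R] [Finite m]
    [Fintype n] {I : Ideal R} {A : Matrix m n R} (hA : ∀ i j, A i j ∈ I) :
    LinearMap.range A.mulVecLin ≤ I • (⊤ : Submodule R (m → R)) := by
  classical
  have := Fintype.ofFinite m
  rintro _ ⟨v, rfl⟩
  rw [Matrix.mulVecLin_apply, pi_eq_sum_univ' (A *ᵥ v)]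
  exact sum_mem fun i _ => Submodule.smul_mem_smul
    (sum_mem fun j _ => I.mul_mem_right _ (hA i j)) Submodule.mem_top

end Graded

lemma isWeightedHomogeneous_halved (i : Fin 10) :
    IsWeightedHomogeneous weight (halved K i) (weight i) := by
  have hX (i) : IsWeightedHomogeneous weight (X i : PolyRing K) (weight i) :=
    isWeightedHomogeneous_X K weight i
  fin_cases i <;> first | exact hX _ | exact (hX 2).C_mul _

variable [CharZero K]

lemma augmentation_surjective : Function.Surjective (augmentation K) := fun f =>
  (presentation_surjective f).imp' (fun F _ => F) fun _ h => h

lemma exact_augmentation : Exact (differential K 0) (augmentation K) := fun _ => by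
  rw [← LinearMap.coe_range, SetLike.mem_coe, mem_range_differential_zero_iff, ← ker_presentation]
  rfl

lemma augmentation_mem_invariantPiece {n : ℕ} {v : FreeModule K (Fin 10) (twists 0)}
    (hv : v ∈ freePiece weight (twists 0) n) : augmentation K v ∈ invariantPiece K n := by
  change (presentation K (v (0 : Fin 1)) : MvPolynomial Coord K).IsHomogeneous n
  rw [presentation_coe]
  exact isWeightedHomogeneous_aeval generator_isHomogeneous (hv (0 : Fin 1) (Set.mem_univ _))

variable (K) in
theorem isMinimalGradedFreeResolution :
    IsMinimalGradedFreeResolution weight (invariantPiece K) twists (differential K)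
      (augmentation K) where
  surjective := augmentation_surjective
  exact_zero := exact_augmentation
  exact_succ := exact_differential
  graded_augmentation _ _ := augmentation_mem_invariantPiece
  graded i _ _ := (isMinimalGradedMatrix_differentialMatrix
    isWeightedHomogeneous_halved i).mulVec_mem_freePiece
  minimal i := range_mulVecLin_le_smul_top (isMinimalGradedMatrix_differentialMatrix
    isWeightedHomogeneous_halved i).mem_irrelevantIdeal

end MinimalResolution

section ProjectiveDimension

open CategoryTheory

section Ring

variable {R : Type u} [CommRing R] {M N : Type u} [AddCommGroup M] [Module R M]
  [AddCommGroup N] [Module R N]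

lemma hasProjectiveDimensionLT_iff_ker [Module.Projective R M] {f : M →ₗ[R] N}
    (hf : Function.Surjective f) (n : ℕ) :
    HasProjectiveDimensionLT (ModuleCat.of R N) (n + 2) ↔
      HasProjectiveDimensionLT (ModuleCat.of R (LinearMap.ker f)) (n + 1) :=
  (LinearMap.shortExact_shortComplexKer hf).hasProjectiveDimensionLT_X₃_iff n
    (ModuleCat.projective_of_categoryTheory_projective (ModuleCat.of R M))

lemma hasProjectiveDimensionLT_one_iff_projective :
    HasProjectiveDimensionLT (ModuleCat.of R M) 1 ↔ Module.Projective R M := by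
  rw [← projective_iff_hasProjectiveDimensionLT_one, ← IsProjective.iff_projective]

section Resolution

variable {F : ℕ → Type u} [∀ i, AddCommGroup (F i)] [∀ i, Module R (F i)]
  [∀ i, Module.Projective R (F i)] {d : ∀ i, F (i + 1) →ₗ[R] F i}

lemma hasProjectiveDimensionLT_range_zero_iff (hd : ∀ i, Exact (d (i + 1)) (d i)) (n k : ℕ) :
    HasProjectiveDimensionLT (ModuleCat.of R (LinearMap.range (d 0))) (n + k + 1) ↔
      HasProjectiveDimensionLT (ModuleCat.of R (LinearMap.range (d n))) (k + 1) := by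
  induction n generalizing k with
  | zero => simp only [zero_add]
  | succ n ih =>
    rw [add_right_comm n 1 k, add_assoc n k 1, ih,
      hasProjectiveDimensionLT_iff_ker (d n).surjective_rangeRestrict, LinearMap.ker_rangeRestrict,
      (hd n).linearMap_ker_eq]

lemma hasProjectiveDimensionLT_iff_projective_range {ε : F 0 →ₗ[R] M}
    (hε : Function.Surjective ε) (hd₀ : Exact (d 0) ε) (hd : ∀ i, Exact (d (i + 1)) (d i)) (n : ℕ) :
    HasProjectiveDimensionLT (ModuleCat.of R M) (n + 2) ↔
      Module.Projective R (LinearMap.range (d n)) := by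
  rw [hasProjectiveDimensionLT_iff_ker hε, hd₀.linearMap_ker_eq,
    ← hasProjectiveDimensionLT_one_iff_projective]
  exact hasProjectiveDimensionLT_range_zero_iff hd n 0

end Resolution

end Ring

-- A splitting of `g` yields a retraction `r` of `f`, and then `P = r (f P) ≤ I • P`.
lemma not_projective_of_range_le_smul_top {R M N P : Type*} [CommRing R] [AddCommGroup M]
    [Module R M] [AddCommGroup N] [Module R N] [AddCommGroup P] [Module R P] {f : P →ₗ[R] M}
    {g : M →ₗ[R] N} (hf : Function.Injective f) (hfg : Exact f g) (hg : Function.Surjective g)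
    {I : Ideal R} (hI : LinearMap.range f ≤ I • ⊤) (hP : I • (⊤ : Submodule R P) ≠ ⊤) :
    ¬ Module.Projective R N := by
  intro _
  obtain ⟨l, hl⟩ := Module.projective_lifting_property g LinearMap.id hg
  obtain ⟨-, r, hr⟩ := (hfg.split_tfae'.out 0 1 :
    (Function.Injective f ∧ ∃ l, g ∘ₗ l = LinearMap.id) ↔ _).1 ⟨hf, l, hl⟩
  refine hP (top_le_iff.1 ?_)
  calc
    ⊤ = (LinearMap.range f).map r := by rw [← LinearMap.range_comp, hr, LinearMap.range_id]
    _ ≤ (I • ⊤ : Submodule R M).map r := Submodule.map_mono hI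
    _ = I • (⊤ : Submodule R M).map r := Submodule.map_smul'' _ _ _
    _ ≤ I • ⊤ := Submodule.smul_mono le_rfl le_top

lemma smul_top_pi_ne_top {R ι : Type*} [CommRing R] [Nonempty ι] {I : Ideal R} (hI : I ≠ ⊤) :
    I • (⊤ : Submodule R (ι → R)) ≠ ⊤ := by
  intro h
  obtain ⟨i⟩ := ‹Nonempty ι›
  have apply_mem : ∀ v ∈ I • (⊤ : Submodule R (ι → R)), v i ∈ I := fun v hv =>
    Submodule.smul_induction_on hv (fun r hr _ _ => I.mul_mem_right _ hr) fun _ _ => I.add_mem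
  exact hI ((Ideal.eq_top_iff_one I).2 (apply_mem 1 (h.ge Submodule.mem_top)))

lemma irrelevantIdeal_ne_top {K : Type u} [Field K] {σ : Type} : irrelevantIdeal K σ ≠ ⊤ := by
  rw [Ne, Ideal.eq_top_iff_one, mem_irrelevantIdeal_iff, map_one]
  exact one_ne_zero

theorem IsMinimalGradedFreeResolution.projectiveDimension_eq {K : Type u} [Field K] {σ : Type}
    {w : σ → ℕ} {M : Type u} [AddCommGroup M] [Module (MvPolynomial σ K) M]
    {ℳ : ℕ → AddSubgroup M} {s : ℕ → List ℕ}
    {δ : ∀ i, FreeModule K σ (s (i + 1)) →ₗ[MvPolynomial σ K] FreeModule K σ (s i)}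
    {ε : FreeModule K σ (s 0) →ₗ[MvPolynomial σ K] M}
    (h : IsMinimalGradedFreeResolution w ℳ s δ ε) {n : ℕ} (hn : s (n + 1) ≠ [])
    (hn' : s (n + 2) = []) :
    projectiveDimension (ModuleCat.of (MvPolynomial σ K) M) = (n + 1 : ℕ) := by
  have hinj : Function.Injective (δ n) := by
    have : IsEmpty (Fin (s (n + 2)).length) := by rw [hn']; exact Fin.isEmpty
    rw [← LinearMap.ker_eq_bot, (h.exact_succ n).linearMap_ker_eq]
    exact LinearMap.range_eq_bot.2 (Subsingleton.elim _ _)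
  have : Nonempty (Fin (s (n + 1)).length) := ⟨⟨0, List.length_pos_of_ne_nil hn⟩⟩
  have projective_iff (m) : HasProjectiveDimensionLT (ModuleCat.of (MvPolynomial σ K) M) (m + 2) ↔
      Module.Projective (MvPolynomial σ K) (LinearMap.range (δ m)) :=
    hasProjectiveDimensionLT_iff_projective_range (F := fun i => FreeModule K σ (s i))
      h.surjective h.exact_zero h.exact_succ m
  refine le_antisymm ((projectiveDimension_le_iff _ _).2 ?_)
    ((projectiveDimension_ge_iff _ _).2 ?_)
  · exact (projective_iff n).2 (Module.Projective.of_equiv (LinearEquiv.ofInjective _ hinj))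
  · cases n with
    | zero =>
      exact fun hM => not_projective_of_range_le_smul_top hinj h.exact_zero h.surjective
        (h.minimal 0) (smul_top_pi_ne_top irrelevantIdeal_ne_top)
        (hasProjectiveDimensionLT_one_iff_projective.1 hM)
    | succ m =>
      refine fun hM => not_projective_of_range_le_smul_top hinj ?_
        (δ m).surjective_rangeRestrict (h.minimal (m + 1))
        (smul_top_pi_ne_top irrelevantIdeal_ne_top) ((projective_iff m).1 hM)
      rw [LinearMap.exact_iff, LinearMap.ker_rangeRestrict, (h.exact_succ m).linearMap_ker_eq]

theorem projectiveDimension_invariantAlgebra (K : Type u) [Field K] [CharZero K] :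
    projectiveDimension (ModuleCat.of (PolyRing K) (invariantAlgebra K)) = 4 :=
  (isMinimalGradedFreeResolution K).projectiveDimension_eq (n := 3) (List.cons_ne_nil _ _) rfl

end ProjectiveDimension

end SL2Inv

end

theorem mainTheorem2 (K : Type*) [Field K] [CharZero K] :
    -- the listed polynomials are homogeneous of the stated degrees and generate the invariants
    (∀ i, (SL2Inv.generator K i).IsHomogeneous (SL2Inv.weight i)) ∧
    Algebra.adjoin K (Set.range (SL2Inv.generator K)) = SL2Inv.invariantAlgebra K ∧
    -- no one of them can be omitted
    (∀ i, Algebra.adjoin K (SL2Inv.generator K '' {i}ᶜ) ≠ SL2Inv.invariantAlgebra K) ∧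
    -- the ideal of relations
    RingHom.ker (SL2Inv.presentation K) = Ideal.span (Set.range (SL2Inv.relation K)) ∧
    -- the minimal graded free resolution
    (∃ δ : ∀ i, SL2Inv.FreeModule K (Fin 10) (SL2Inv.twists (i + 1)) →ₗ[SL2Inv.PolyRing K]
        SL2Inv.FreeModule K (Fin 10) (SL2Inv.twists i),
      SL2Inv.IsMinimalGradedFreeResolution SL2Inv.weight (SL2Inv.invariantPiece K)
        SL2Inv.twists δ (SL2Inv.augmentation K)) ∧
    -- the homological dimension
    CategoryTheory.projectiveDimension
      (ModuleCat.of (SL2Inv.PolyRing K) (SL2Inv.invariantAlgebra K)) = 4 := by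
  refine ⟨SL2Inv.generator_isHomogeneous, SL2Inv.adjoin_generator,
    SL2Inv.adjoin_generator_image_compl_ne, ?_,
    ⟨SL2Inv.differential K, SL2Inv.isMinimalGradedFreeResolution K⟩,
    SL2Inv.projectiveDimension_invariantAlgebra K⟩
  exact SL2Inv.ker_presentation.trans (SL2Inv.span_relation K).symm
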